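/- Let $p_1\neq p_2$ and $q$ be primes with $p_1\equiv p_2\equiv -q\equiv 1\pmod 4$, and put $K_3=\mathbb{Q}(\sqrt q,\sqrt{p_1p_2},i)\subset\mathbb{C}$. Let $K_3^+$ be its maximal real subfield. For a number field $k$ write $E_k$ for the unit group of its ring of integers and $W_k$ for its group of roots of unity. A fundamental system of units (F.S.U.) of $k$ is a family $u_1,\dots,u_r\in E_k$ such that every element of $E_k$ is uniquely of the form $\zeta u_1^{e_1}\cdots u_r^{e_r}$ with $\zeta\in W_k$, $e_j\in\mathbb{Z}$. For a square-free integer $m>1$ let $\varepsilon_m>1$ be the fundamental unit of $\mathbb{Q}(\sqrt m)$, and let $N$ be the norm from $\mathbb{Q}(\sqrt{p_1p_2})$ to $\mathbb{Q}$. Write $\varepsilon_{p_1p_2q}=x+y\sqrt{p_1p_2q}$ with $x,y\in\mathbb{Q}$. For $c\in\mathbb{N}$, "$c(x\pm1)$ is a square" means that $c(x+1)$ or $c(x-1)$ is the square of a natural number. Then $K_3$ is a CM-field with Hasse unit index $Q_{K_3}=[E_{K_3}:W_{K_3}E_{K_3^+}]=2$, and the following hold. (A) Suppose $N(\varepsilon_{p_1p_2})=1$.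 1. If $2q(x\pm1)$ is a square, then $\{\varepsilon_q,\varepsilon_{p_1p_2},\sqrt{\varepsilon_{p_1p_2q}}\}$ is an F.S.U. of $K_3^+$ and $\{\varepsilon_{p_1p_2},\sqrt{\varepsilon_{p_1p_2q}},\sqrt{i\varepsilon_q}\}$ is an F.S.U. of $K_3$. 2. If $x\pm1$ or $q(x\pm1)$ is a square, then $\{\varepsilon_q,\varepsilon_{p_1p_2},\sqrt{\varepsilon_q\varepsilon_{p_1p_2q}}\}$ is an F.S.U. of $K_3^+$ and $\{\varepsilon_{p_1p_2},\sqrt{\varepsilon_q\varepsilon_{p_1p_2q}},\sqrt{i\varepsilon_q}\}$ is an F.S.U. of $K_3$. 3. If $p_1(x\pm1)$ or $p_2(x\pm1)$ is a square, then $\{\varepsilon_q,\varepsilon_{p_1p_2},\sqrt{\varepsilon_q\varepsilon_{p_1p_2}\varepsilon_{p_1p_2q}}\}$ is an F.S.U. of $K_3^+$ and $\{\varepsilon_{p_1p_2},\sqrt{\varepsilon_q\varepsilon_{p_1p_2}\varepsilon_{p_1p_2q}},\sqrt{i\varepsilon_q}\}$ is an F.S.U. of $K_3$. 4. If $2p_1(x\pm1)$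 or $2p_2(x\pm1)$ is a square, then $\{\varepsilon_q,\varepsilon_{p_1p_2},\sqrt{\varepsilon_{p_1p_2}\varepsilon_{p_1p_2q}}\}$ is an F.S.U. of $K_3^+$ and $\{\varepsilon_{p_1p_2},\sqrt{\varepsilon_{p_1p_2}\varepsilon_{p_1p_2q}},\sqrt{i\varepsilon_q}\}$ is an F.S.U. of $K_3$. (B) Suppose $N(\varepsilon_{p_1p_2})=-1$. 1. If $2q(x\pm1)$ is a square, then $\{\varepsilon_q,\varepsilon_{p_1p_2},\sqrt{\varepsilon_{p_1p_2q}}\}$ is an F.S.U. of $K_3^+$ and $\{\varepsilon_{p_1p_2},\sqrt{\varepsilon_{p_1p_2q}},\sqrt{i\varepsilon_q}\}$ is an F.S.U. of $K_3$. 2. If $x\pm1$ or $q(x\pm1)$ is a square, then $\{\varepsilon_q,\varepsilon_{p_1p_2},\sqrt{\varepsilon_q\varepsilon_{p_1p_2q}}\}$ is an F.S.U. of $K_3^+$ and $\{\varepsilon_{p_1p_2},\sqrt{\varepsilon_q\varepsilon_{p_1p_2q}},\sqrt{i\varepsilon_q}\}$ is an F.S.U. of $K_3$. 3. If none of $2q(x\pm1)$,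 $x\pm1$, $q(x\pm1)$ is a square, then $\{\varepsilon_q,\varepsilon_{p_1p_2},\varepsilon_{p_1p_2q}\}$ is an F.S.U. of $K_3^+$ and $\{\varepsilon_{p_1p_2},\varepsilon_{p_1p_2q},\sqrt{i\varepsilon_q}\}$ is an F.S.U. of $K_3$. -/

import Mathlib

open NumberField

/-- A fundamental system of units of `K`: every unit of the ring of integers is uniquely
`ζ * u₁ ^ e₁ * ⋯ * uₙ ^ eₙ` with `ζ` a root of unity of `K` and integers `eᵢ`. -/
def IsFundamentalSystem (K : Type*) [Field K] {n : ℕ} (u : Fin n → (𝓞 K)ˣ) : Prop :=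
  ∀ v : (𝓞 K)ˣ, ∃! e : Units.torsion K × (Fin n → ℤ), v = e.1 * ∏ i, u i ^ e.2 i

/-- The numbers `u i` lie in the subfield `φ(K)` of `L`, are units of its ring of integers,
and form a fundamental system of units of it. -/
def IsFundamentalSystemIn {K L : Type*} [Field K] [Field L] (φ : K →+* L) {n : ℕ}
    (u : Fin n → L) : Prop :=
  ∃ v : Fin n → (𝓞 K)ˣ, (∀ i, φ (v i : K) = u i) ∧ IsFundamentalSystem K v

/-- The quadratic field `ℚ(√m)`, as a subfield of `ℝ`. -/
noncomputable abbrev RealQuadratic (m : ℕ) : IntermediateField ℚ ℝ :=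
  IntermediateField.adjoin ℚ {√(m : ℝ)}

/-- `ε` is the fundamental unit of `ℚ(√m)`: the unit `ε > 1` generating the units up to the
roots of unity `±1`. -/
def IsFundamentalUnit (m : ℕ) (ε : ℝ) : Prop :=
  1 < ε ∧ IsFundamentalSystemIn (algebraMap (RealQuadratic m) ℝ) ![ε]

/-- The real number `ε` lies in `ℚ(√m)` and its norm from `ℚ(√m)` to `ℚ` is `c`. -/
def HasQuadraticNorm (m : ℕ) (ε : ℝ) (c : ℚ) : Prop :=
  ∃ z : RealQuadratic m, (z : ℝ) = ε ∧ Algebra.norm ℚ z = c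

/-- The field `ℚ(√a, √b, i)`, as a subfield of `ℂ`. -/
noncomputable abbrev FieldK (a b : ℕ) : IntermediateField ℚ ℂ :=
  IntermediateField.adjoin ℚ {((√(a : ℝ) : ℝ) : ℂ), ((√(b : ℝ) : ℝ) : ℂ), Complex.I}

/-- The real numbers `u i` form a fundamental system of units of the maximal real subfield
of `ℚ(√a, √b, i)`. -/
def IsFSUPlus (a b : ℕ) (u : Fin 3 → ℝ) : Prop :=
  IsFundamentalSystemIn
    ((algebraMap (FieldK a b) ℂ).comp (maximalRealSubfield (FieldK a b)).subtype)
    (fun j => (u j : ℂ))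

/-- The complex numbers `u i` form a fundamental system of units of `ℚ(√a, √b, i)`. -/
def IsFSU (a b : ℕ) (u : Fin 3 → ℂ) : Prop :=
  IsFundamentalSystemIn (algebraMap (FieldK a b) ℂ) u

/-- The principal square root of a complex number. -/
noncomputable def csqrt (z : ℂ) : ℂ := z ^ (2⁻¹ : ℂ)

/-- The rational number `r` is the square of a natural number. -/
def IsSquareInNat (r : ℚ) : Prop := ∃ n : ℕ, r = (n : ℚ) ^ 2

/-- `c (x ± 1)` is a square in `ℕ`, for at least one choice of the sign. -/
def SquarePM (c : ℕ) (x : ℚ) : Prop :=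
  IsSquareInNat (c * (x + 1)) ∨ IsSquareInNat (c * (x - 1))

/-! Write `r = p₁p₂`, `K⁺ = ℚ(√q, √r)`, and `ε₁, ε₂, ε₃` for the fundamental units of `ℚ(√q)`,
`ℚ(√r)`, `ℚ(√(rq))`. If `σ`, `τ` generate the Galois group of `K⁺`, then `z² =
(z·τz)(z·σz)(σz·τz)⁻¹`, and each factor lies in a quadratic subfield. So the square of every unit
is, up to sign, a monomial in the `εᵢ`, and everything reduces to deciding which monomials `ε₁^a
ε₂^b ε₃^c` are squares in `K⁺`.

This is decided by rational numbers. A unit `ε = a + b√m > 1` of norm `1` satisfies `(1 + ε)² = ε(2a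
+ 2)`, so it has the square class of `2a + 2`. Factoring `a² - 1 = m b²` into coprime parts gives
`ε₁ ~ 2`, and `ε₂ ~ p₁` when its norm is `1`; moreover `ε₃ ~ 2(x + 1)`. A rational number is a
square in `K⁺` only if it is a rational square times `1`, `q`, `r` or `rq`, so `2`, `p₁`, `2p₁` are
not squares there. When `ε₂` has norm `-1`, a sign argument replaces its class: `τ` makes `ε₂`
negative and keeps `ε₁`, `ε₃` positive, so `ε₂` occurs in a square with even exponent.

For `K = K⁺(i)`, the number `√(iε₁) = ±(1 + i)/2 · √(2ε₁)` lies in `K` because `2ε₁` is a square in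
`K⁺`. It is not a root of unity times a real unit: absolute values would make `ε₁` a square in `K⁺`.
Hence the Hasse index, which is `1` or `2`, equals `2`, and replacing `ε₁` by `√(iε₁)` turns a
fundamental system of `K⁺` into one of `K`. -/

/-! ### Units viewed inside an ambient field -/

/-- A nonzero `z` such that `z` and `z⁻¹` are algebraic integers. -/
def IsIntegralUnit {L : Type*} [Field L] (z : L) : Prop :=
  z ≠ 0 ∧ IsIntegral ℤ z ∧ IsIntegral ℤ z⁻¹

namespace IsIntegralUnit

variable {L M : Type*} [Field L] [Field M] {z w : L}

theorem one : IsIntegralUnit (1 : L) :=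
  ⟨one_ne_zero, isIntegral_one, by simpa using isIntegral_one⟩

theorem mul (hz : IsIntegralUnit z) (hw : IsIntegralUnit w) : IsIntegralUnit (z * w) :=
  ⟨mul_ne_zero hz.1 hw.1, hz.2.1.mul hw.2.1, by rw [mul_inv]; exact hz.2.2.mul hw.2.2⟩

theorem inv (hz : IsIntegralUnit z) : IsIntegralUnit z⁻¹ :=
  ⟨inv_ne_zero hz.1, hz.2.2, by simpa using hz.2.1⟩

theorem neg (hz : IsIntegralUnit z) : IsIntegralUnit (-z) :=
  ⟨neg_ne_zero.mpr hz.1, hz.2.1.neg, by rw [inv_neg]; exact hz.2.2.neg⟩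

theorem map_iff (φ : L →+* M) : IsIntegralUnit (φ z) ↔ IsIntegralUnit z := by
  have key (x : L) : IsIntegral ℤ (φ x) ↔ IsIntegral ℤ x :=
    isIntegral_algHom_iff φ.toIntAlgHom φ.injective
  unfold IsIntegralUnit
  rw [← map_inv₀, key, key, map_ne_zero]

theorem of_sq (h : IsIntegralUnit (z ^ 2)) : IsIntegralUnit z := by
  refine ⟨fun h0 => h.1 (by simp [h0]), h.2.1.of_pow two_pos, ?_⟩
  exact IsIntegral.of_pow two_pos (by rw [inv_pow]; exact h.2.2)

end IsIntegralUnit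

/-- Integrality over `ℤ` does not depend on the surrounding field. This lets all later arguments
take place in `ℝ` or `ℂ`, where units of different subfields can be multiplied. -/
theorem exists_unit_map_eq_iff {K L : Type*} [Field K] [Field L] (φ : K →+* L) (z : L) :
    (∃ v : (𝓞 K)ˣ, φ (v : K) = z) ↔ z ∈ φ.range ∧ IsIntegralUnit z := by
  constructor
  · rintro ⟨v, rfl⟩
    refine ⟨⟨_, rfl⟩, (IsIntegralUnit.map_iff φ).mpr ⟨?_, RingOfIntegers.isIntegral_coe _, ?_⟩⟩
    · exact Units.coe_ne_zero v
    · have h : ((v : K))⁻¹ = ((v⁻¹ : (𝓞 K)ˣ) : K) := by simp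
      rw [h]
      exact RingOfIntegers.isIntegral_coe _
  · rintro ⟨⟨k, rfl⟩, h⟩
    obtain ⟨h0, h1, h2⟩ := (IsIntegralUnit.map_iff φ).mp h
    refine ⟨⟨⟨k, h1⟩, ⟨k⁻¹, h2⟩, ?_, ?_⟩, rfl⟩ <;> apply RingOfIntegers.ext
    · exact mul_inv_cancel₀ h0
    · exact inv_mul_cancel₀ h0

/-- Fundamental systems of units of `K`, described inside the larger field `L`. -/
theorem isFundamentalSystemIn_iff {K L : Type*} [Field K] [Field L]
    (φ : K →+* L) {n : ℕ} (u : Fin n → L) :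
    IsFundamentalSystemIn φ u ↔
      (∀ i, u i ∈ φ.range ∧ IsIntegralUnit (u i)) ∧
      (∀ z ∈ φ.range, IsIntegralUnit z →
        ∃ ζ : L, (∃ k : ℕ, 0 < k ∧ ζ ^ k = 1) ∧ ∃ e : Fin n → ℤ, z = ζ * ∏ i, u i ^ e i) ∧
      (∀ (e : Fin n → ℤ) (k : ℕ), 0 < k → (∏ i, u i ^ e i) ^ k = 1 → e = 0) := by
  have hmap (v : Fin n → (𝓞 K)ˣ) (e : Fin n → ℤ) :
      φ ((∏ i, v i ^ e i : (𝓞 K)ˣ) : K) = ∏ i, φ (v i : K) ^ e i := by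
    simp [Units.coe_prod, map_prod, NumberField.Units.coe_zpow]
  have hinj {a b : (𝓞 K)ˣ} (h : φ (a : K) = φ (b : K)) : a = b :=
    Units.coe_injective K (φ.injective h)
  constructor
  · rintro ⟨v, hv, hfs⟩
    obtain rfl : (fun i => φ (v i : K)) = u := funext hv
    refine ⟨fun i => (exists_unit_map_eq_iff φ _).mp ⟨v i, rfl⟩, fun z hz hu => ?_, ?_⟩
    · obtain ⟨w, rfl⟩ := (exists_unit_map_eq_iff φ z).mpr ⟨hz, hu⟩
      obtain ⟨⟨ζ, e⟩, he, -⟩ := hfs w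
      refine ⟨φ ((ζ : (𝓞 K)ˣ) : K), ?_, e, ?_⟩
      · obtain ⟨k, hk, h1⟩ := isOfFinOrder_iff_pow_eq_one.mp ((CommGroup.mem_torsion _).mp ζ.2)
        refine ⟨k, hk, ?_⟩
        rw [← map_pow, ← Units.coe_pow, h1]
        simp
      · simp only at he
        rw [← hmap, ← map_mul, ← Units.coe_mul, ← he]
    · intro e k hk h
      have h1 : (∏ i, v i ^ e i) ^ k = 1 := by
        apply hinj
        rw [Units.coe_pow, map_pow, hmap, h]
        simp
      have ht : ∏ i, v i ^ e i ∈ Units.torsion K :=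
        (CommGroup.mem_torsion _).mpr (isOfFinOrder_iff_pow_eq_one.mpr ⟨k, hk, h1⟩)
      have := (hfs (∏ i, v i ^ e i)).unique (y₁ := ⟨1, e⟩) (y₂ := ⟨⟨_, ht⟩, 0⟩) (by simp)
        (by simp)
      exact (Prod.ext_iff.mp this).2
  · rintro ⟨h1, h2, h3⟩
    choose v hv using fun i => (exists_unit_map_eq_iff φ (u i)).mpr (h1 i)
    obtain rfl : (fun i => φ (v i : K)) = u := funext hv
    refine ⟨v, fun _ => rfl, fun w => ?_⟩
    obtain ⟨hw1, hw2⟩ := (exists_unit_map_eq_iff φ _).mp ⟨w, rfl⟩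
    obtain ⟨ζ, ⟨k, hk, hζ⟩, e, he⟩ := h2 _ hw1 hw2
    have hζ' : φ ((w * (∏ i, v i ^ e i)⁻¹ : (𝓞 K)ˣ) : K) = ζ := by
      rw [← hmap] at he
      rw [Units.coe_mul, map_mul, he, mul_assoc, ← map_mul, ← Units.coe_mul]
      simp
    have ht : w * (∏ i, v i ^ e i)⁻¹ ∈ Units.torsion K := by
      refine (CommGroup.mem_torsion _).mpr (isOfFinOrder_iff_pow_eq_one.mpr ⟨k, hk, hinj ?_⟩)
      rw [Units.coe_pow, map_pow, hζ', hζ]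
      simp
    refine ⟨⟨⟨_, ht⟩, e⟩, by simp, ?_⟩
    rintro ⟨ξ, f⟩ hf
    simp only at hf
    obtain ⟨l, hl, hξ⟩ := isOfFinOrder_iff_pow_eq_one.mp ((CommGroup.mem_torsion _).mp ξ.2)
    obtain ⟨k', hk', hζ''⟩ := isOfFinOrder_iff_pow_eq_one.mp ((CommGroup.mem_torsion _).mp ht)
    -- Two representations of `w` differ by a quotient of two roots of unity, so the monomial with
    -- exponents `e - f` has finite order and independence applies.
    have hef : (∏ i, v i ^ (e - f) i) ^ (k' * l) = 1 := by
      have h4 : ∏ i, v i ^ (e - f) i = (w * (∏ i, v i ^ e i)⁻¹)⁻¹ * ξ := by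
        simp only [Pi.sub_apply, zpow_sub, Finset.prod_mul_distrib, Finset.prod_inv_distrib]
        rw [hf, mul_inv_rev, inv_inv, mul_inv_rev, mul_assoc, mul_assoc, inv_mul_cancel, mul_one]
      rw [h4, mul_pow, inv_pow, pow_mul, hζ'', mul_comm k', pow_mul _ l, hξ]
      simp
    have h0 := h3 (e - f) (k' * l) (Nat.mul_pos hk' hl) (by
      rw [← hmap, ← map_pow, ← Units.coe_pow, hef]; simp)
    obtain rfl : e = f := sub_eq_zero.mp h0
    refine Prod.ext (Subtype.ext ?_) rfl
    simp [hf]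

/-! ### Fields generated by square roots -/

section SquareRoots

variable {L : Type*} [Field L] [CharZero L]

/-- A field generated over `ℚ` by square roots of rational numbers is Galois. -/
theorem isGalois_adjoin_of_sq_mem {S : Set L} (hS : ∀ s ∈ S, ∃ c : ℚ, s ^ 2 = c) :
    IsGalois ℚ (IntermediateField.adjoin ℚ S) := by
  have hint (s) (hs : s ∈ S) : IsIntegral ℚ s := by
    obtain ⟨c, hc⟩ := hS s hs
    exact IsIntegral.of_pow two_pos (hc ▸ isIntegral_algebraMap (x := c))
  have hn : Normal ℚ (IntermediateField.adjoin ℚ S) := by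
    refine normal_iff.mpr fun x => ⟨?_, ?_⟩
    · have : Algebra.IsAlgebraic ℚ (IntermediateField.adjoin ℚ S) :=
        IntermediateField.isAlgebraic_adjoin hint
      exact (Algebra.IsAlgebraic.isAlgebraic x).isIntegral
    · rw [show minpoly ℚ x = minpoly ℚ (x : L) from IntermediateField.minpoly_eq x]
      refine IntermediateField.splits_of_mem_adjoin ℚ L (S := S) (fun s hs => ⟨hint s hs, ?_⟩) x.2
      obtain ⟨c, hc⟩ := hS s hs
      let t : IntermediateField.adjoin ℚ S := ⟨s, IntermediateField.subset_adjoin _ _ hs⟩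
      have hdvd : minpoly ℚ s ∣ Polynomial.X ^ 2 - Polynomial.C c := by
        apply minpoly.dvd
        simp [hc]
      have ht : t ^ 2 = algebraMap ℚ _ c := Subtype.ext (by simpa [t] using hc)
      have hfac : (Polynomial.X ^ 2 - Polynomial.C c : Polynomial ℚ).map
          (algebraMap ℚ (IntermediateField.adjoin ℚ S)) =
          (Polynomial.X - Polynomial.C t) * (Polynomial.X - Polynomial.C (-t)) := by
        rw [Polynomial.map_sub, Polynomial.map_pow, Polynomial.map_X, Polynomial.map_C, ← ht]
        simp only [map_neg, map_pow]
        ring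
      refine Polynomial.Splits.of_dvd (g := (Polynomial.X ^ 2 - Polynomial.C c :
        Polynomial ℚ).map (algebraMap ℚ (IntermediateField.adjoin ℚ S))) ?_ ?_
        (Polynomial.map_dvd _ hdvd)
      · rw [hfac]
        exact (Polynomial.Splits.X_sub_C _).mul (Polynomial.Splits.X_sub_C _)
      · rw [hfac]
        exact mul_ne_zero (Polynomial.X_sub_C_ne_zero _) (Polynomial.X_sub_C_ne_zero _)
  exact ⟨⟩

theorem finiteDimensional_adjoin_of_sq_mem {S : Set L} [Finite S]
    (hS : ∀ s ∈ S, ∃ c : ℚ, s ^ 2 = c) :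
    FiniteDimensional ℚ (IntermediateField.adjoin ℚ S) := by
  refine IntermediateField.finiteDimensional_adjoin fun s hs => ?_
  obtain ⟨c, hc⟩ := hS s hs
  exact IsIntegral.of_pow two_pos (hc ▸ isIntegral_algebraMap (x := c))

theorem map_eq_or_eq_neg_of_sq_eq {K : Type*} [Field K] [CharZero K] (σ : K →ₐ[ℚ] L)
    (τ : K →ₐ[ℚ] L) {s : K} {c : ℚ} (h : s ^ 2 = c) : σ s = τ s ∨ σ s = -τ s := by
  apply sq_eq_sq_iff_eq_or_eq_neg.mp
  rw [← map_pow, ← map_pow, h]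
  simp

end SquareRoots

/-! ### Quadratic fields and their fundamental units -/

theorem mem_realQuadratic_iff {m : ℕ} {z : ℝ} :
    z ∈ RealQuadratic m ↔ ∃ a b : ℚ, z = a + b * √(m : ℝ) := by
  constructor
  · intro hz
    have hs : √(m : ℝ) ^ 2 = m := Real.sq_sqrt (Nat.cast_nonneg m)
    have hint : IsIntegral ℚ √(m : ℝ) := IsIntegral.of_pow two_pos (by
      rw [hs]; exact isIntegral_algebraMap (x := (m : ℚ)))
    rw [← IntermediateField.mem_toSubalgebra,
      IntermediateField.adjoin_simple_toSubalgebra_of_isAlgebraic hint.isAlgebraic] at hz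
    induction hz using Algebra.adjoin_induction with
    | mem x hx => exact ⟨0, 1, by simp_all⟩
    | algebraMap r => exact ⟨r, 0, by simp⟩
    | add x y _ _ hx hy =>
      obtain ⟨a, b, rfl⟩ := hx
      obtain ⟨c, d, rfl⟩ := hy
      exact ⟨a + c, b + d, by push_cast; ring⟩
    | mul x y _ _ hx hy =>
      obtain ⟨a, b, rfl⟩ := hx
      obtain ⟨c, d, rfl⟩ := hy
      exact ⟨a * c + m * (b * d), a * d + b * c, by push_cast; linear_combination b * d * hs⟩
  · rintro ⟨a, b, rfl⟩
    exact add_mem (IntermediateField.algebraMap_mem _ a)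
      (mul_mem (IntermediateField.algebraMap_mem _ b)
        (IntermediateField.mem_adjoin_simple_self ℚ _))

theorem Nat.not_isSquare_rat_of_squarefree {m : ℕ} (hm : Squarefree m) (h1 : m ≠ 1) :
    ¬ IsSquare (m : ℚ) := by
  rw [Rat.isSquare_natCast_iff]
  rintro ⟨k, rfl⟩
  exact h1 (by simpa using hm k dvd_rfl)

instance (m : ℕ) : IsGalois ℚ (RealQuadratic m) :=
  isGalois_adjoin_of_sq_mem (by
    rintro s rfl
    exact ⟨m, by simp⟩)

instance (m : ℕ) : NumberField (RealQuadratic m) where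
  to_finiteDimensional := finiteDimensional_adjoin_of_sq_mem (by
    rintro s rfl
    exact ⟨m, by simp⟩)

/-- The field `F` is any field containing `√m`, so that the formula serves both `ℚ(√m)` itself and
the biquadratic field above it. -/
theorem coe_map_eq_conj {m : ℕ} {F : IntermediateField ℚ ℝ} (σ : F ≃ₐ[ℚ] F) {s : F}
    (hs : (s : ℝ) = √(m : ℝ)) (hσ : σ s = -s) {a b : ℚ} {z : F}
    (hz : (z : ℝ) = a + b * √(m : ℝ)) : (σ z : ℝ) = a - b * √(m : ℝ) := by
  obtain rfl : z = a + b * s := Subtype.ext (by rw [hz, ← hs]; push_cast; rfl)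
  have h : σ (a + b * s) = a - b * s := by
    rw [map_add, map_mul, hσ, map_ratCast, map_ratCast]
    ring
  rw [h, ← hs]
  push_cast
  rfl

theorem irrational_sqrt_of_not_isSquare {m : ℕ} (hm : ¬ IsSquare (m : ℚ)) (c : ℚ) :
    √(m : ℝ) ≠ c := by
  intro h
  apply hm
  refine ⟨c, ?_⟩
  have : (m : ℝ) = c * c := by rw [← h, Real.mul_self_sqrt (Nat.cast_nonneg m)]
  exact_mod_cast this

/-- The nontrivial automorphism of `ℚ(√m)`. -/
theorem exists_realQuadratic_conj {m : ℕ} (hm : ¬ IsSquare (m : ℚ)) :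
    ∃ σ : RealQuadratic m ≃ₐ[ℚ] RealQuadratic m, σ ≠ 1 ∧
      (∀ (z : RealQuadratic m) (a b : ℚ), (z : ℝ) = a + b * √(m : ℝ) →
        (σ z : ℝ) = a - b * √(m : ℝ)) ∧ ∀ g : RealQuadratic m ≃ₐ[ℚ] RealQuadratic m,
          g = 1 ∨ g = σ := by
  let s : RealQuadratic m := ⟨√(m : ℝ), IntermediateField.mem_adjoin_simple_self ℚ _⟩
  have hs2 : s ^ 2 = ((m : ℚ) : RealQuadratic m) := Subtype.ext (by simp [s])
  have hsn : ¬ ∀ f : RealQuadratic m ≃ₐ[ℚ] RealQuadratic m, f s = s := by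
    intro h
    obtain ⟨c, hc⟩ := (IsGalois.mem_range_algebraMap_iff_fixed s).mpr h
    apply irrational_sqrt_of_not_isSquare hm c
    have := congrArg (Subtype.val) hc
    simpa [s] using this.symm
  have hg (g : RealQuadratic m ≃ₐ[ℚ] RealQuadratic m) : g s = s ∨ g s = -s := by
    simpa using map_eq_or_eq_neg_of_sq_eq (g : RealQuadratic m →ₐ[ℚ] RealQuadratic m)
      (AlgHom.id ℚ _) hs2
  push Not at hsn
  obtain ⟨σ, hσ⟩ := hsn
  have hσs := (hg σ).resolve_left hσ
  have hext (g h : RealQuadratic m ≃ₐ[ℚ] RealQuadratic m) (e : g s = h s) : g = h := by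
    ext z
    obtain ⟨a, b, hab⟩ := mem_realQuadratic_iff.mp z.2
    obtain rfl : z = a + b * s := Subtype.ext (by rw [hab]; push_cast; rfl)
    simp only [map_add, map_mul, map_ratCast, e]
  refine ⟨σ, ?_, fun z a b hz => coe_map_eq_conj σ rfl hσs hz, fun g => ?_⟩
  · rintro rfl
    exact hσ rfl
  · rcases hg g with h | h
    · exact Or.inl (hext _ _ h)
    · exact Or.inr (hext _ _ (h.trans hσs.symm))

theorem HasQuadraticNorm.eq {m : ℕ} (hm : ¬ IsSquare (m : ℚ)) {a b c : ℚ}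
    (h : HasQuadraticNorm m (a + b * √(m : ℝ)) c) : c = a ^ 2 - m * b ^ 2 := by
  obtain ⟨z, hz, rfl⟩ := h
  obtain ⟨σ, hσ, hconj, hall⟩ := exists_realQuadratic_conj hm
  classical
  have huniv : (Finset.univ : Finset (RealQuadratic m ≃ₐ[ℚ] RealQuadratic m)) = {1, σ} := by
    ext g
    simpa using hall g
  have h := Algebra.norm_eq_prod_automorphisms ℚ z
  rw [huniv, Finset.prod_pair hσ.symm] at h
  have h' := congrArg Subtype.val h
  have hs : √(m : ℝ) ^ 2 = m := Real.sq_sqrt (Nat.cast_nonneg m)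
  have h'' : ((Algebra.norm ℚ z : ℚ) : ℝ) = (z : ℝ) * (σ z : ℝ) := by simpa using h'
  rw [hconj z a b hz, hz] at h''
  have : ((Algebra.norm ℚ z : ℚ) : ℝ) = ((a ^ 2 - m * b ^ 2 : ℚ) : ℝ) := by
    rw [h'']
    push_cast
    linear_combination (-b ^ 2 : ℝ) * hs
  exact_mod_cast this

theorem exists_int_eq_of_isIntegral {L : Type*} [Field L] [CharZero L] {c : ℚ}
    (h : IsIntegral ℤ (c : L)) : ∃ n : ℤ, c = n := by
  have h' : IsIntegral ℤ c :=
    (isIntegral_algHom_iff (Rat.castHom L).toIntAlgHom (Rat.castHom L).injective).mp h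
  obtain ⟨n, hn⟩ := IsIntegrallyClosed.isIntegral_iff.mp h'
  exact ⟨n, by simpa using hn.symm⟩

theorem IsIntegralUnit.rat_eq {L : Type*} [Field L] [CharZero L] {c : ℚ}
    (h : IsIntegralUnit (c : L)) : c = 1 ∨ c = -1 := by
  obtain ⟨n, hn⟩ := exists_int_eq_of_isIntegral h.2.1
  obtain ⟨k, hk⟩ := exists_int_eq_of_isIntegral (c := c⁻¹) (by
    have := h.2.2
    rwa [← Rat.cast_inv] at this)
  have hc : c ≠ 0 := by
    rintro rfl
    exact h.1 (by simp)
  have h1 : n * k = 1 := by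
    have : (n : ℚ) * k = 1 := by rw [← hn, ← hk, mul_inv_cancel₀ hc]
    exact_mod_cast this
  rcases Int.eq_one_or_neg_one_of_mul_eq_one h1 with rfl | rfl <;> simp [hn]

/-- The trace `2a` and the norm are integral rationals, and the norm is moreover a unit of `ℤ`. For
`2b`, the number `(2mb)²` is `m` times an integer; as `m` is squarefree it divides `2mb`. -/
theorem IsIntegralUnit.exists_int_quadratic {m : ℕ} (hm : Squarefree m) (hm1 : m ≠ 1) {a b : ℚ}
    (h : IsIntegralUnit ((a : ℝ) + b * √(m : ℝ))) :
    (∃ A B : ℤ, 2 * a = A ∧ 2 * b = B) ∧ (a ^ 2 - m * b ^ 2 = 1 ∨ a ^ 2 - m * b ^ 2 = -1) := by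
  have hs : √(m : ℝ) ^ 2 = m := Real.sq_sqrt (Nat.cast_nonneg m)
  obtain ⟨σ, -, hconj, -⟩ :=
    exists_realQuadratic_conj (Nat.not_isSquare_rat_of_squarefree hm hm1)
  let z : RealQuadratic m := ⟨_, mem_realQuadratic_iff.mpr ⟨a, b, rfl⟩⟩
  have h' : IsIntegralUnit ((a : ℝ) - b * √(m : ℝ)) := by
    rw [← hconj z a b rfl]
    have hz : IsIntegralUnit z := (IsIntegralUnit.map_iff (algebraMap (RealQuadratic m) ℝ)).mp h
    have hz' : IsIntegralUnit (σ z) := (IsIntegralUnit.map_iff σ.toRingEquiv.toRingHom).mpr hz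
    exact (IsIntegralUnit.map_iff (algebraMap (RealQuadratic m) ℝ)).mpr hz'
  have hN : IsIntegralUnit (((a ^ 2 - m * b ^ 2 : ℚ)) : ℝ) := by
    convert h.mul h' using 1
    push_cast
    linear_combination (b ^ 2 : ℝ) * hs
  obtain ⟨A, hA⟩ := exists_int_eq_of_isIntegral (L := ℝ) (c := 2 * a) (by
    have he : ((2 * a : ℚ) : ℝ) = (a + b * √(m : ℝ)) + (a - b * √(m : ℝ)) := by
      push_cast
      ring
    rw [he]
    exact h.2.1.add h'.2.1)
  obtain ⟨N, hN'⟩ := exists_int_eq_of_isIntegral hN.2.1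
  refine ⟨?_, hN.rat_eq⟩
  have hsq : (m * (2 * b)) ^ 2 = (((m : ℤ) * (A ^ 2 - 4 * N) : ℤ) : ℚ) := by
    push_cast
    rw [← hA, ← hN']
    ring
  obtain ⟨C, hC⟩ := exists_int_eq_of_isIntegral (L := ℚ) (c := m * (2 * b)) (by
    refine IsIntegral.of_pow two_pos ?_
    rw [Rat.cast_id, hsq]
    exact isIntegral_algebraMap (x := ((m : ℤ) * (A ^ 2 - 4 * N))))
  have hdvd : (m : ℤ) ∣ C := by
    have hmz : Squarefree (m : ℤ) := Int.squarefree_natCast.mpr hm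
    refine (hmz.dvd_pow_iff_dvd two_ne_zero).mp ⟨A ^ 2 - 4 * N, ?_⟩
    rw [hC] at hsq
    exact_mod_cast hsq
  obtain ⟨B, rfl⟩ := hdvd
  refine ⟨A, B, hA, ?_⟩
  have hm0 : (m : ℚ) ≠ 0 := by exact_mod_cast hm.ne_zero
  push_cast at hC
  exact mul_left_cancel₀ hm0 hC

theorem IsFundamentalUnit.mem {m : ℕ} {ε : ℝ} (h : IsFundamentalUnit m ε) :
    ε ∈ RealQuadratic m ∧ IsIntegralUnit ε := by
  have := ((isFundamentalSystemIn_iff _ _).mp h.2).1 0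
  refine ⟨?_, by simpa using this.2⟩
  obtain ⟨⟨z, hz⟩, -⟩ := this
  have hz' : (z : ℝ) = ε := hz
  exact hz' ▸ z.2

theorem IsFundamentalUnit.exists_zpow {m : ℕ} {ε z : ℝ} (h : IsFundamentalUnit m ε)
    (hz : z ∈ RealQuadratic m) (hu : IsIntegralUnit z) : ∃ n : ℤ, z = ε ^ n ∨ z = -ε ^ n := by
  obtain ⟨ζ, ⟨k, hk, hζ⟩, e, he⟩ :=
    ((isFundamentalSystemIn_iff _ _).mp h.2).2.1 z ⟨⟨z, hz⟩, rfl⟩ hu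
  have h1 : |ζ| = 1 := by
    rw [← pow_eq_one_iff_of_nonneg (abs_nonneg ζ) hk.ne', ← abs_pow, hζ, abs_one]
  refine ⟨e 0, ?_⟩
  rcases eq_or_eq_neg_of_abs_eq h1 with rfl | rfl <;> simp [he]

/-- A square root would be a unit `±ε ^ n`, forcing `1 = 2n`. -/
theorem IsFundamentalUnit.ne_sq {m : ℕ} {ε w : ℝ} (h : IsFundamentalUnit m ε)
    (hw : w ∈ RealQuadratic m) : ε ≠ w ^ 2 := by
  intro he
  obtain ⟨n, hn⟩ := h.exists_zpow hw (IsIntegralUnit.of_sq (he ▸ h.mem.2))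
  have h2 : ε ^ (1 : ℤ) = ε ^ (2 * n) := by
    rw [zpow_one, mul_comm, zpow_mul]
    rcases hn with rfl | rfl
    · exact_mod_cast he
    · rw [neg_sq] at he
      exact_mod_cast he
  have := zpow_right_injective₀ (zero_lt_one.trans h.1) h.1.ne' h2
  omega

theorem IsFundamentalUnit.exists_coeffs {m : ℕ} {ε : ℝ} (hm : Squarefree m) (hm1 : m ≠ 1)
    (h : IsFundamentalUnit m ε) : ∃ a b : ℚ, ε = a + b * √(m : ℝ) ∧
      (∃ A B : ℤ, 2 * a = A ∧ 2 * b = B) ∧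
      (a ^ 2 - m * b ^ 2 = 1 ∨ a ^ 2 - m * b ^ 2 = -1) := by
  obtain ⟨a, b, hab⟩ := mem_realQuadratic_iff.mp h.mem.1
  exact ⟨a, b, hab, IsIntegralUnit.exists_int_quadratic hm hm1 (hab ▸ h.mem.2)⟩

/-! ### The real biquadratic field and its Galois group -/

/-- The field `ℚ(√q, √r)`, as a subfield of `ℝ`. -/
noncomputable abbrev RealBiquadratic (q r : ℕ) : IntermediateField ℚ ℝ :=
  IntermediateField.adjoin ℚ {√(q : ℝ), √(r : ℝ)}

theorem sq_eq_ratCast_of_mem_pair {q r : ℕ} :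
    ∀ s ∈ ({√(q : ℝ), √(r : ℝ)} : Set ℝ), ∃ c : ℚ, s ^ 2 = c := by
  rintro s (rfl | rfl)
  · exact ⟨q, by simp⟩
  · exact ⟨r, by simp⟩

instance (q r : ℕ) : IsGalois ℚ (RealBiquadratic q r) :=
  isGalois_adjoin_of_sq_mem sq_eq_ratCast_of_mem_pair

instance (q r : ℕ) : NumberField (RealBiquadratic q r) where
  to_finiteDimensional := finiteDimensional_adjoin_of_sq_mem sq_eq_ratCast_of_mem_pair

theorem sqrt_left_mem (q r : ℕ) : √(q : ℝ) ∈ RealBiquadratic q r :=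
  IntermediateField.subset_adjoin _ _ (by simp)

theorem sqrt_right_mem (q r : ℕ) : √(r : ℝ) ∈ RealBiquadratic q r :=
  IntermediateField.subset_adjoin _ _ (by simp)

theorem mem_realBiquadratic_iff {q r : ℕ} {z : ℝ} : z ∈ RealBiquadratic q r ↔
    ∃ a b c d : ℚ, z = a + b * √(q : ℝ) + c * √(r : ℝ) + d * (√(q : ℝ) * √(r : ℝ)) := by
  constructor
  · intro hz
    have hs : √(q : ℝ) ^ 2 = q := Real.sq_sqrt (Nat.cast_nonneg q)
    have ht : √(r : ℝ) ^ 2 = r := Real.sq_sqrt (Nat.cast_nonneg r)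
    have hint : ∀ x ∈ ({√(q : ℝ), √(r : ℝ)} : Set ℝ), IsAlgebraic ℚ x := by
      intro x hx
      obtain ⟨c, hc⟩ := sq_eq_ratCast_of_mem_pair x hx
      exact (IsIntegral.of_pow two_pos (hc ▸ isIntegral_algebraMap (x := c))).isAlgebraic
    rw [← IntermediateField.mem_toSubalgebra,
      IntermediateField.adjoin_toSubalgebra_of_isAlgebraic hint] at hz
    induction hz using Algebra.adjoin_induction with
    | mem x hx =>
      rcases hx with rfl | rfl
      · exact ⟨0, 1, 0, 0, by simp⟩
      · exact ⟨0, 0, 1, 0, by simp⟩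
    | algebraMap x => exact ⟨x, 0, 0, 0, by simp⟩
    | add x y _ _ hx hy =>
      obtain ⟨a, b, c, d, rfl⟩ := hx
      obtain ⟨a', b', c', d', rfl⟩ := hy
      exact ⟨a + a', b + b', c + c', d + d', by push_cast; ring⟩
    | mul x y _ _ hx hy =>
      obtain ⟨a, b, c, d, rfl⟩ := hx
      obtain ⟨a', b', c', d', rfl⟩ := hy
      generalize √(q : ℝ) = s at *
      generalize √(r : ℝ) = t at *
      refine ⟨a * a' + q * (b * b') + r * (c * c') + q * r * (d * d'),
        a * b' + b * a' + r * (c * d' + d * c'), a * c' + c * a' + q * (b * d' + d * b'),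
        a * d' + d * a' + b * c' + c * b', ?_⟩
      push_cast
      rw [← hs, ← ht]
      ring
  · rintro ⟨a, b, c, d, rfl⟩
    have h (x : ℚ) : (x : ℝ) ∈ RealBiquadratic q r := IntermediateField.algebraMap_mem _ x
    exact add_mem (add_mem (add_mem (h a) (mul_mem (h b) (sqrt_left_mem q r)))
      (mul_mem (h c) (sqrt_right_mem q r)))
      (mul_mem (h d) (mul_mem (sqrt_left_mem q r) (sqrt_right_mem q r)))

theorem realQuadratic_left_le (q r : ℕ) : RealQuadratic q ≤ RealBiquadratic q r :=
  IntermediateField.adjoin.mono _ _ _ (by simp)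

theorem realQuadratic_right_le (q r : ℕ) : RealQuadratic r ≤ RealBiquadratic q r :=
  IntermediateField.adjoin.mono _ _ _ (by simp)

theorem realQuadratic_mul_le (q r : ℕ) : RealQuadratic (r * q) ≤ RealBiquadratic q r := by
  rw [IntermediateField.adjoin_simple_le_iff]
  simp only [Nat.cast_mul, Real.sqrt_mul (Nat.cast_nonneg r)]
  exact mul_mem (sqrt_right_mem q r) (sqrt_left_mem q r)

/-- Squaring `√q = a + b√r` makes `2ab√r` rational, so `ab = 0`. Then `√q` is `a`, or it is `b√r`
and `rq` is a square. -/
theorem sqrt_notMem_realQuadratic {q r : ℕ} (hq : ¬ IsSquare (q : ℚ)) (hr : ¬ IsSquare (r : ℚ))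
    (hqr : ¬ IsSquare ((r * q : ℕ) : ℚ)) : √(q : ℝ) ∉ RealQuadratic r := by
  intro h
  obtain ⟨a, b, hab⟩ := mem_realQuadratic_iff.mp h
  have hs : √(q : ℝ) ^ 2 = q := Real.sq_sqrt (Nat.cast_nonneg q)
  have ht : √(r : ℝ) ^ 2 = r := Real.sq_sqrt (Nat.cast_nonneg r)
  have h1 : 2 * a * b * √(r : ℝ) = ((q - a ^ 2 - r * b ^ 2 : ℚ) : ℝ) := by
    push_cast
    rw [hab] at hs
    linear_combination hs - b ^ 2 * ht
  by_cases h0 : a * b = 0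
  · rcases mul_eq_zero.mp h0 with rfl | rfl
    · refine hqr ⟨b * r, ?_⟩
      have : ((r * q : ℕ) : ℝ) = ((b * r * (b * r) : ℚ) : ℝ) := by
        rw [hab] at hs
        push_cast at hs ⊢
        linear_combination -r * hs + b ^ 2 * r * ht
      exact_mod_cast this
    · exact irrational_sqrt_of_not_isSquare hq a (by simpa using hab)
  · refine irrational_sqrt_of_not_isSquare hr ((q - a ^ 2 - r * b ^ 2) / (2 * (a * b))) ?_
    have h0' : (2 * (a * b) : ℝ) ≠ 0 := by exact_mod_cast mul_ne_zero two_ne_zero h0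
    rw [Rat.cast_div, ← h1, eq_div_iff (by exact_mod_cast h0')]
    push_cast
    ring

/-- By the Galois correspondence, `F ∩ E` is the fixed field of the automorphisms fixing it, so one
of them moves `s`. The field `E` need not lie in `F`, hence the `comap`. -/
theorem exists_aut_of_notMem {F E : IntermediateField ℚ ℝ} [IsGalois ℚ F] [NumberField F]
    {s : F} {c : ℚ} (hs : s ^ 2 = c) (hE : (s : ℝ) ∉ E) :
    ∃ σ : F ≃ₐ[ℚ] F, σ s = -s ∧ ∀ t : F, (t : ℝ) ∈ E → σ t = t := by
  let f : F →ₐ[ℚ] ℝ := { algebraMap F ℝ with commutes' := fun x => by simp }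
  have hmem : s ∉ IntermediateField.fixedField (IntermediateField.fixingSubgroup (E.comap f)) := by
    rw [IsGalois.fixedField_fixingSubgroup]
    exact hE
  rw [IntermediateField.mem_fixedField_iff] at hmem
  push Not at hmem
  obtain ⟨σ, hσ, hσs⟩ := hmem
  refine ⟨σ, ?_, fun t ht => ?_⟩
  · have := map_eq_or_eq_neg_of_sq_eq (σ : F →ₐ[ℚ] F) (AlgHom.id ℚ _) hs
    exact this.resolve_left hσs
  · exact (IntermediateField.mem_fixingSubgroup_iff _ _).mp hσ t ht

/-- The quadratic fields `ℚ(√q)`, `ℚ(√r)`, `ℚ(√(qr))` are fields of degree `2`. -/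
structure IsBiquadraticPair (q r : ℕ) : Prop where
  left : ¬ IsSquare (q : ℚ)
  right : ¬ IsSquare (r : ℚ)
  mul : ¬ IsSquare ((r * q : ℕ) : ℚ)

/-- `√q` as an element of `ℚ(√q, √r)`. -/
noncomputable def sqrtLeft (q r : ℕ) : RealBiquadratic q r := ⟨_, sqrt_left_mem q r⟩

/-- `√r` as an element of `ℚ(√q, √r)`. -/
noncomputable def sqrtRight (q r : ℕ) : RealBiquadratic q r := ⟨_, sqrt_right_mem q r⟩

theorem sqrtLeft_sq (q r : ℕ) : sqrtLeft q r ^ 2 = ((q : ℚ) : RealBiquadratic q r) :=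
  Subtype.ext (by simp [sqrtLeft])

theorem sqrtRight_sq (q r : ℕ) : sqrtRight q r ^ 2 = ((r : ℚ) : RealBiquadratic q r) :=
  Subtype.ext (by simp [sqrtRight])

/-- A pair of generators of the Galois group of `ℚ(√q, √r)`: `σ` changes the sign of `√q` only,
`τ` that of `√r` only. -/
structure IsConjPair {q r : ℕ} (σ τ : RealBiquadratic q r ≃ₐ[ℚ] RealBiquadratic q r) : Prop where
  left_left : σ (sqrtLeft q r) = -sqrtLeft q r
  left_right : σ (sqrtRight q r) = sqrtRight q r
  right_left : τ (sqrtLeft q r) = sqrtLeft q r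
  right_right : τ (sqrtRight q r) = -sqrtRight q r

theorem IsBiquadraticPair.exists_isConjPair {q r : ℕ} (h : IsBiquadraticPair q r) :
    ∃ σ τ : RealBiquadratic q r ≃ₐ[ℚ] RealBiquadratic q r, IsConjPair σ τ := by
  obtain ⟨σ, hσ, hσ'⟩ := exists_aut_of_notMem (E := RealQuadratic r) (sqrtLeft_sq q r)
    (sqrt_notMem_realQuadratic h.left h.right h.mul)
  obtain ⟨τ, hτ, hτ'⟩ := exists_aut_of_notMem (E := RealQuadratic q) (sqrtRight_sq q r)
    (sqrt_notMem_realQuadratic h.right h.left (by rw [mul_comm]; exact h.mul))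
  exact ⟨σ, τ, hσ, hσ' _ (IntermediateField.mem_adjoin_simple_self ℚ _),
    hτ' _ (IntermediateField.mem_adjoin_simple_self ℚ _), hτ⟩

theorem RealBiquadratic.exists_coeffs {q r : ℕ} (z : RealBiquadratic q r) :
    ∃ a b c d : ℚ, z = a + b * sqrtLeft q r + c * sqrtRight q r +
      d * (sqrtLeft q r * sqrtRight q r) := by
  obtain ⟨a, b, c, d, h⟩ := mem_realBiquadratic_iff.mp z.2
  exact ⟨a, b, c, d, Subtype.ext (by rw [h]; push_cast; rfl)⟩

namespace IsConjPair

variable {q r : ℕ} {σ τ : RealBiquadratic q r ≃ₐ[ℚ] RealBiquadratic q r}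

theorem left_apply (h : IsConjPair σ τ) (a b c d : ℚ) :
    σ (a + b * sqrtLeft q r + c * sqrtRight q r + d * (sqrtLeft q r * sqrtRight q r)) =
      a - b * sqrtLeft q r + c * sqrtRight q r - d * (sqrtLeft q r * sqrtRight q r) := by
  simp only [map_add, map_mul, map_ratCast, h.left_left, h.left_right]
  ring

theorem right_apply (h : IsConjPair σ τ) (a b c d : ℚ) :
    τ (a + b * sqrtLeft q r + c * sqrtRight q r + d * (sqrtLeft q r * sqrtRight q r)) =
      a + b * sqrtLeft q r - c * sqrtRight q r - d * (sqrtLeft q r * sqrtRight q r) := by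
  simp only [map_add, map_mul, map_ratCast, h.right_left, h.right_right]
  ring

theorem left_left_apply (h : IsConjPair σ τ) (z) : σ (σ z) = z := by
  obtain ⟨a, b, c, d, rfl⟩ := RealBiquadratic.exists_coeffs z
  simp only [map_add, map_mul, map_ratCast, h.left_left, h.left_right, map_neg]
  ring

theorem right_right_apply (h : IsConjPair σ τ) (z) : τ (τ z) = z := by
  obtain ⟨a, b, c, d, rfl⟩ := RealBiquadratic.exists_coeffs z
  simp only [map_add, map_mul, map_ratCast, h.right_left, h.right_right, map_neg]
  ring

theorem apply_comm (h : IsConjPair σ τ) (z) : σ (τ z) = τ (σ z) := by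
  obtain ⟨a, b, c, d, rfl⟩ := RealBiquadratic.exists_coeffs z
  simp only [map_add, map_mul, map_ratCast, h.right_left, h.right_right, h.left_left,
    h.left_right, map_neg]

theorem mem_right_of_fixed (h : IsConjPair σ τ) {z} (hz : σ z = z) :
    (z : ℝ) ∈ RealQuadratic r := by
  obtain ⟨a, b, c, d, rfl⟩ := RealBiquadratic.exists_coeffs z
  rw [h.left_apply] at hz
  refine mem_realQuadratic_iff.mpr ⟨a, c, ?_⟩
  have := congrArg Subtype.val hz
  push_cast [sqrtLeft, sqrtRight] at this ⊢
  linear_combination (-1 / 2) * this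

theorem mem_left_of_fixed (h : IsConjPair σ τ) {z} (hz : τ z = z) :
    (z : ℝ) ∈ RealQuadratic q := by
  obtain ⟨a, b, c, d, rfl⟩ := RealBiquadratic.exists_coeffs z
  rw [h.right_apply] at hz
  refine mem_realQuadratic_iff.mpr ⟨a, b, ?_⟩
  have := congrArg Subtype.val hz
  push_cast [sqrtLeft, sqrtRight] at this ⊢
  linear_combination (-1 / 2) * this

theorem mem_mul_of_fixed (h : IsConjPair σ τ) {z} (hz : σ (τ z) = z) :
    (z : ℝ) ∈ RealQuadratic (r * q) := by
  obtain ⟨a, b, c, d, rfl⟩ := RealBiquadratic.exists_coeffs z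
  refine mem_realQuadratic_iff.mpr ⟨a, d, ?_⟩
  simp only [map_add, map_mul, map_ratCast, h.right_left, h.right_right, h.left_left,
    h.left_right, map_neg] at hz
  have := congrArg Subtype.val hz
  push_cast [sqrtLeft, sqrtRight, Real.sqrt_mul (Nat.cast_nonneg r)] at this ⊢
  linear_combination (-1 / 2) * this

theorem eq_ratCast_of_fixed (h : IsConjPair σ τ) {z} (hσ : σ z = z) (hτ : τ z = z) :
    ∃ a : ℚ, z = a := by
  obtain ⟨a, b, c, d, rfl⟩ := RealBiquadratic.exists_coeffs z
  have h1 := congrArg τ hσ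
  rw [h.left_apply] at hσ
  rw [h.right_apply] at hτ
  rw [h.left_apply, h.right_apply] at h1
  simp only [map_add, map_sub, map_mul, map_ratCast, h.right_left, h.right_right] at h1
  refine ⟨a, ?_⟩
  linear_combination (-1 / 4) * hσ - (1 / 2) * hτ - (1 / 4) * h1

end IsConjPair

theorem isIntegralUnit_coe_iff {F : IntermediateField ℚ ℝ} {z : F} :
    IsIntegralUnit (z : ℝ) ↔ IsIntegralUnit z :=
  IsIntegralUnit.map_iff (algebraMap F ℝ)

theorem IsIntegralUnit.algEquiv {K : Type*} [Field K] [Algebra ℚ K] {z : K} (hz : IsIntegralUnit z)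
    (σ : K ≃ₐ[ℚ] K) : IsIntegralUnit (σ z) :=
  (IsIntegralUnit.map_iff σ.toRingEquiv.toRingHom).mpr hz

theorem IsIntegralUnit.zpow {L : Type*} [Field L] {z : L} (hz : IsIntegralUnit z) (n : ℤ) :
    IsIntegralUnit (z ^ n) := by
  have hpow (k : ℕ) : IsIntegralUnit (z ^ k) := by
    induction k with
    | zero => simpa using IsIntegralUnit.one
    | succ k ih => rw [pow_succ]; exact ih.mul hz
  obtain ⟨k, rfl | rfl⟩ := n.eq_nat_or_neg
  · simpa using hpow k
  · simpa using (hpow k).inv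

namespace IsConjPair

variable {q r : ℕ} {σ τ : RealBiquadratic q r ≃ₐ[ℚ] RealBiquadratic q r}

/-- A rational number that is a square in `ℚ(√q, √r)` is a rational square times one of
`1`, `q`, `r`, `qr`. -/
theorem isSquare_of_sq_eq (h : IsConjPair σ τ) {w : RealBiquadratic q r} {c : ℚ}
    (hw : w ^ 2 = c) :
    IsSquare c ∨ IsSquare (c * q) ∨ IsSquare (c * r) ∨ IsSquare (c * (r * q)) := by
  have key {v : RealBiquadratic q r} {d : ℚ} (hv : v ^ 2 = d) (h1 : σ v = v) (h2 : τ v = v) :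
      IsSquare d := by
    obtain ⟨a, rfl⟩ := h.eq_ratCast_of_fixed h1 h2
    refine ⟨a, ?_⟩
    rw [← sq]
    exact_mod_cast hv.symm
  have hs := sqrtLeft_sq q r
  have ht := sqrtRight_sq q r
  -- Each of `σ`, `τ` multiplies `w` by a sign. Multiplying `w` by the one of `1`, `√q`, `√r`,
  -- `√(rq)` with the same signs gives a fixed, hence rational, number.
  have hσ : σ w = w ∨ σ w = -w :=
    map_eq_or_eq_neg_of_sq_eq (σ : _ →ₐ[ℚ] RealBiquadratic q r) (AlgHom.id ℚ _) hw
  have hτ : τ w = w ∨ τ w = -w :=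
    map_eq_or_eq_neg_of_sq_eq (τ : _ →ₐ[ℚ] RealBiquadratic q r) (AlgHom.id ℚ _) hw
  rcases hσ with hσ | hσ <;> rcases hτ with hτ | hτ
  · exact Or.inl (key hw hσ hτ)
  · refine Or.inr (Or.inr (Or.inl (key (v := w * sqrtRight q r) ?_ ?_ ?_)))
    · rw [mul_pow, hw, ht]; push_cast; rfl
    · rw [map_mul, hσ, h.left_right]
    · rw [map_mul, hτ, h.right_right, neg_mul_neg]
  · refine Or.inr (Or.inl (key (v := w * sqrtLeft q r) ?_ ?_ ?_))
    · rw [mul_pow, hw, hs]; push_cast; rfl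
    · rw [map_mul, hσ, h.left_left, neg_mul_neg]
    · rw [map_mul, hτ, h.right_left]
  · refine Or.inr (Or.inr (Or.inr (key (v := w * (sqrtRight q r * sqrtLeft q r)) ?_ ?_ ?_)))
    · rw [mul_pow, mul_pow, hw, hs, ht]; push_cast; rfl
    · rw [map_mul, map_mul, hσ, h.left_left, h.left_right]; ring
    · rw [map_mul, map_mul, hτ, h.right_left, h.right_right]; ring

/-- The square of a unit of `ℚ(√q, √r)` is a product of units of the quadratic subfields. -/
theorem exists_sq_eq_mul (h : IsConjPair σ τ) {z : RealBiquadratic q r} (hz : IsIntegralUnit z) :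
    ∃ n₁ ∈ RealQuadratic q, ∃ n₂ ∈ RealQuadratic r, ∃ n₃ ∈ RealQuadratic (r * q),
      IsIntegralUnit n₁ ∧ IsIntegralUnit n₂ ∧ IsIntegralUnit n₃ ∧ (z : ℝ) ^ 2 = n₁ * n₂ * n₃ := by
  have hσ := hz.algEquiv σ
  have hτ := hz.algEquiv τ
  -- The first two factors are the relative norms of `z` to `ℚ(√q)` and `ℚ(√r)`; the third is the
  -- inverse of the `σ`-conjugate of its norm to `ℚ(√(rq))`.
  refine ⟨((z * τ z : RealBiquadratic q r) : ℝ), h.mem_left_of_fixed ?_,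
    ((z * σ z : RealBiquadratic q r) : ℝ), h.mem_right_of_fixed ?_,
    (((σ z * τ z)⁻¹ : RealBiquadratic q r) : ℝ), h.mem_mul_of_fixed ?_,
    isIntegralUnit_coe_iff.mpr (hz.mul hτ), isIntegralUnit_coe_iff.mpr (hz.mul hσ),
    isIntegralUnit_coe_iff.mpr (hσ.mul hτ).inv, ?_⟩
  · rw [map_mul, h.right_right_apply, mul_comm]
  · rw [map_mul, h.left_left_apply, mul_comm]
  · rw [map_inv₀, map_inv₀, map_mul, map_mul, h.right_right_apply, ← h.apply_comm,
      h.left_left_apply, mul_comm]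
  · have := hσ.1
    have := hτ.1
    have e : z ^ 2 = z * τ z * (z * σ z) * (σ z * τ z)⁻¹ := by
      field_simp
    exact congrArg Subtype.val e

end IsConjPair

/-! ### Fundamental systems built from the three quadratic units -/

/-- The data of fundamental units of the three quadratic subfields of `ℚ(√q, √r)`, where `q` and
`r` are coprime squarefree integers greater than `1`. -/
structure QuadraticUnits (q r : ℕ) (ε₁ ε₂ ε₃ : ℝ) : Prop where
  squarefree : Squarefree (r * q)
  left_ne : q ≠ 1
  right_ne : r ≠ 1
  left : IsFundamentalUnit q ε₁
  right : IsFundamentalUnit r ε₂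
  mul : IsFundamentalUnit (r * q) ε₃

/-- The positive units `u`, `v`, `w` form a fundamental system of units of `ℚ(√q, √r)`. -/
structure IsRealFSU (q r : ℕ) (u v w : ℝ) : Prop where
  pos : 0 < u ∧ 0 < v ∧ 0 < w
  mem : u ∈ RealBiquadratic q r ∧ v ∈ RealBiquadratic q r ∧ w ∈ RealBiquadratic q r
  unit : IsIntegralUnit u ∧ IsIntegralUnit v ∧ IsIntegralUnit w
  exists_eq : ∀ z ∈ RealBiquadratic q r, IsIntegralUnit z → 0 < z →
    ∃ a b c : ℤ, z = u ^ a * v ^ b * w ^ c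
  indep : ∀ a b c : ℤ, u ^ a * v ^ b * w ^ c = 1 → a = 0 ∧ b = 0 ∧ c = 0

namespace QuadraticUnits

variable {q r : ℕ} {ε₁ ε₂ ε₃ : ℝ}

theorem squarefree_left (h : QuadraticUnits q r ε₁ ε₂ ε₃) : Squarefree q :=
  h.squarefree.squarefree_of_dvd (dvd_mul_left q r)

theorem squarefree_right (h : QuadraticUnits q r ε₁ ε₂ ε₃) : Squarefree r :=
  h.squarefree.squarefree_of_dvd (dvd_mul_right r q)

theorem mul_ne (h : QuadraticUnits q r ε₁ ε₂ ε₃) : r * q ≠ 1 :=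
  fun e => h.left_ne (Nat.eq_one_of_mul_eq_one_left e)

theorem isBiquadraticPair (h : QuadraticUnits q r ε₁ ε₂ ε₃) : IsBiquadraticPair q r :=
  ⟨Nat.not_isSquare_rat_of_squarefree h.squarefree_left h.left_ne,
    Nat.not_isSquare_rat_of_squarefree h.squarefree_right h.right_ne,
    Nat.not_isSquare_rat_of_squarefree h.squarefree h.mul_ne⟩

theorem pos (h : QuadraticUnits q r ε₁ ε₂ ε₃) : 0 < ε₁ ∧ 0 < ε₂ ∧ 0 < ε₃ :=
  ⟨one_pos.trans h.left.1, one_pos.trans h.right.1, one_pos.trans h.mul.1⟩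

theorem mem (h : QuadraticUnits q r ε₁ ε₂ ε₃) :
    ε₁ ∈ RealBiquadratic q r ∧ ε₂ ∈ RealBiquadratic q r ∧ ε₃ ∈ RealBiquadratic q r :=
  ⟨realQuadratic_left_le q r h.left.mem.1, realQuadratic_right_le q r h.right.mem.1,
    realQuadratic_mul_le q r h.mul.mem.1⟩

theorem exists_sq_eq (h : QuadraticUnits q r ε₁ ε₂ ε₃) {z : ℝ} (hz : z ∈ RealBiquadratic q r)
    (hu : IsIntegralUnit z) : ∃ a b c : ℤ, z ^ 2 = ε₁ ^ a * ε₂ ^ b * ε₃ ^ c := by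
  obtain ⟨σ, τ, hστ⟩ := h.isBiquadraticPair.exists_isConjPair
  obtain ⟨n₁, hn₁, n₂, hn₂, n₃, hn₃, u₁, u₂, u₃, e⟩ :=
    hστ.exists_sq_eq_mul (z := ⟨z, hz⟩) (isIntegralUnit_coe_iff.mp hu)
  obtain ⟨a, ha⟩ := h.left.exists_zpow hn₁ u₁
  obtain ⟨b, hb⟩ := h.right.exists_zpow hn₂ u₂
  obtain ⟨c, hc⟩ := h.mul.exists_zpow hn₃ u₃
  obtain ⟨p₁, p₂, p₃⟩ := h.pos
  refine ⟨a, b, c, ?_⟩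
  have habs {n x : ℝ} (hx : 0 < x) (hn : n = x ∨ n = -x) : |n| = x := by
    rcases hn with rfl | rfl
    · exact abs_of_pos hx
    · rw [abs_neg, abs_of_pos hx]
  have := congrArg abs e
  rw [abs_mul, abs_mul, habs (zpow_pos p₁ a) ha, habs (zpow_pos p₂ b) hb,
    habs (zpow_pos p₃ c) hc, abs_of_nonneg (sq_nonneg _)] at this
  exact this

end QuadraticUnits

/-- The product of `ε` and its conjugate is the norm `±1`. Absolute values make the sign of the norm
irrelevant. -/
theorem IsFundamentalUnit.abs_mul_conj {m : ℕ} {ε : ℝ} (hm : Squarefree m) (hm1 : m ≠ 1)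
    (h : IsFundamentalUnit m ε) {F : IntermediateField ℚ ℝ} (σ : F ≃ₐ[ℚ] F) {s z : F}
    (hs : (s : ℝ) = √(m : ℝ)) (hσ : σ s = -s) (hz : (z : ℝ) = ε) :
    |ε| * |(σ z : ℝ)| = 1 := by
  obtain ⟨a, b, hab, -, hN⟩ := h.exists_coeffs hm hm1
  have h1 := coe_map_eq_conj σ hs hσ (hz.trans hab)
  have hsq : √(m : ℝ) ^ 2 = m := Real.sq_sqrt (Nat.cast_nonneg m)
  rw [← abs_mul, h1, hab]
  have h2 : (a + b * √(m : ℝ)) * (a - b * √(m : ℝ)) = ((a ^ 2 - m * b ^ 2 : ℚ) : ℝ) := by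
    push_cast
    linear_combination (-b ^ 2 : ℝ) * hsq
  rw [h2]
  rcases hN with hN | hN <;> simp [hN]

theorem coe_map_of_mem_realQuadratic {m : ℕ} {F : IntermediateField ℚ ℝ} (σ : F ≃ₐ[ℚ] F) {s z : F}
    (hs : (s : ℝ) = √(m : ℝ)) (hσ : σ s = s) (hz : (z : ℝ) ∈ RealQuadratic m) : σ z = z := by
  obtain ⟨a, b, hab⟩ := mem_realQuadratic_iff.mp hz
  obtain rfl : z = a + b * s := Subtype.ext (by rw [hab, ← hs]; push_cast; rfl)
  rw [map_add, map_mul, hσ, map_ratCast, map_ratCast]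

namespace QuadraticUnits

variable {q r : ℕ} {ε₁ ε₂ ε₃ : ℝ}

/-- In absolute value `σ` fixes `ε₂` and inverts `ε₁`, `ε₃`. Multiplying the relation by its
conjugate leaves `ε₂ ^ (2b) = 1`, so `b = 0`. The same argument with `τ` gives `a = 0`. -/
theorem indep (h : QuadraticUnits q r ε₁ ε₂ ε₃) {a b c : ℤ}
    (e : ε₁ ^ a * ε₂ ^ b * ε₃ ^ c = 1) : a = 0 ∧ b = 0 ∧ c = 0 := by
  obtain ⟨σ, τ, hστ⟩ := h.isBiquadraticPair.exists_isConjPair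
  obtain ⟨m₁, m₂, m₃⟩ := h.mem
  obtain ⟨p₁, p₂, p₃⟩ := h.pos
  have hmul : ((sqrtRight q r * sqrtLeft q r : RealBiquadratic q r) : ℝ) =
      √((r * q : ℕ) : ℝ) := by
    rw [Nat.cast_mul, Real.sqrt_mul (Nat.cast_nonneg r)]
    rfl
  have e' : (⟨ε₁, m₁⟩ : RealBiquadratic q r) ^ a * ⟨ε₂, m₂⟩ ^ b * ⟨ε₃, m₃⟩ ^ c = 1 :=
    Subtype.ext (by push_cast; exact e)
  have zpow_zero {x : ℝ} {n : ℤ} (hx : 1 < x) (hn : (x * x) ^ n = 1) : n = 0 :=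
    (zpow_eq_one_iff_right₀ (by positivity) (by nlinarith : 1 < x * x).ne').mp hn
  have conj (g : RealBiquadratic q r ≃ₐ[ℚ] RealBiquadratic q r) :
      |(g ⟨ε₁, m₁⟩ : ℝ)| ^ a * |(g ⟨ε₂, m₂⟩ : ℝ)| ^ b * |(g ⟨ε₃, m₃⟩ : ℝ)| ^ c = 1 := by
    have := congrArg (fun z => |algebraMap (RealBiquadratic q r) ℝ (g z)|) e'
    simp only [map_mul, map_zpow₀, abs_mul, abs_zpow, map_one, abs_one] at this
    exact this
  have inv {x y : ℝ} (hx : 0 < x) (hxy : |x| * |y| = 1) : |y| = x⁻¹ := by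
    rw [abs_of_pos hx] at hxy
    exact eq_inv_of_mul_eq_one_right hxy
  have mid {x y z : ℝ} (hx : x ≠ 0) (hz : z ≠ 0) (h1 : x * y * z = 1)
      (h2 : x⁻¹ * y * z⁻¹ = 1) : y * y = 1 := by
    calc y * y = (x * y * z) * (x⁻¹ * y * z⁻¹) := by field_simp
      _ = 1 := by rw [h1, h2, one_mul]
  have hb : b = 0 := by
    have hσ := conj σ
    rw [inv p₁ (h.left.abs_mul_conj h.squarefree_left h.left_ne σ (z := ⟨ε₁, m₁⟩) (s := sqrtLeft q r)
      rfl hστ.left_left rfl),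
      coe_map_of_mem_realQuadratic σ (z := ⟨ε₂, m₂⟩) (s := sqrtRight q r) rfl hστ.left_right
        h.right.mem.1,
      inv p₃ (h.mul.abs_mul_conj h.squarefree h.mul_ne σ (z := ⟨ε₃, m₃⟩) hmul
        (by rw [map_mul, hστ.left_left, hστ.left_right, mul_neg]) rfl), abs_of_pos p₂] at hσ
    apply zpow_zero h.right.1
    rw [inv_zpow, inv_zpow] at hσ
    rw [mul_zpow]
    exact mid (zpow_pos p₁ a).ne' (zpow_pos p₃ c).ne' e hσ
  have ha : a = 0 := by
    have hτ := conj τ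
    rw [inv p₂ (h.right.abs_mul_conj h.squarefree_right h.right_ne τ (z := ⟨ε₂, m₂⟩)
      (s := sqrtRight q r) rfl hστ.right_right rfl),
      coe_map_of_mem_realQuadratic τ (z := ⟨ε₁, m₁⟩) (s := sqrtLeft q r) rfl hστ.right_left
        h.left.mem.1,
      inv p₃ (h.mul.abs_mul_conj h.squarefree h.mul_ne τ (z := ⟨ε₃, m₃⟩) hmul
        (by rw [map_mul, hστ.right_left, hστ.right_right, neg_mul]) rfl), abs_of_pos p₁] at hτ
    apply zpow_zero h.left.1
    rw [inv_zpow, inv_zpow, mul_comm (ε₁ ^ a)] at hτ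
    rw [mul_zpow]
    rw [mul_comm (ε₁ ^ a)] at e
    exact mid (zpow_pos p₂ b).ne' (zpow_pos p₃ c).ne' e hτ
  subst ha hb
  refine ⟨rfl, rfl, ?_⟩
  have : ε₃ ^ c = 1 := by simpa using e
  exact (zpow_eq_one_iff_right₀ p₃.le h.mul.1.ne').mp this

/-- Since `ε₃` occurs in `η²` to the first power, dividing a unit `z` by `η ^ c` removes `ε₃` from
its square altogether. Hence only the monomials in `ε₁`, `ε₂` need a parity condition. -/
theorem isRealFSU_of_sq_eq (h : QuadraticUnits q r ε₁ ε₂ ε₃) {η : ℝ} (hη : 0 < η)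
    (hmem : η ∈ RealBiquadratic q r) {α β : ℤ} (hsq : η ^ 2 = ε₁ ^ α * ε₂ ^ β * ε₃)
    (hpar : ∀ a b : ℤ, (∃ w ∈ RealBiquadratic q r, w ^ 2 = ε₁ ^ a * ε₂ ^ b) → Even a ∧ Even b) :
    IsRealFSU q r ε₁ ε₂ η := by
  obtain ⟨p₁, p₂, p₃⟩ := h.pos
  have hpow (c : ℤ) : (η ^ c) ^ 2 = ε₁ ^ (α * c) * ε₂ ^ (β * c) * ε₃ ^ c := by
    rw [← zpow_natCast, zpow_comm, zpow_natCast, hsq, mul_zpow, mul_zpow, zpow_mul, zpow_mul]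
  refine ⟨⟨p₁, p₂, hη⟩, ⟨h.mem.1, h.mem.2.1, hmem⟩, ⟨h.left.mem.2, h.right.mem.2,
    IsIntegralUnit.of_sq ?_⟩, ?_, ?_⟩
  · rw [hsq]
    exact ((h.left.mem.2.zpow α).mul (h.right.mem.2.zpow β)).mul h.mul.mem.2
  · intro z hz hu hpos
    obtain ⟨a, b, c, e⟩ := h.exists_sq_eq hz hu
    have e' : (z * (η ^ c)⁻¹) ^ 2 = ε₁ ^ (a - α * c) * ε₂ ^ (b - β * c) := by
      rw [mul_pow, inv_pow, hpow, e, zpow_sub₀ p₁.ne', zpow_sub₀ p₂.ne']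
      have := (zpow_pos p₃ c).ne'
      field_simp
    obtain ⟨⟨k, hk⟩, ⟨l, hl⟩⟩ := hpar _ _ ⟨_, mul_mem hz (inv_mem (zpow_mem hmem c)), e'⟩
    refine ⟨k, l, c, ?_⟩
    have hc := zpow_pos hη c
    rw [← mul_inv_eq_iff_eq_mul₀ hc.ne']
    refine (pow_left_inj₀ (by positivity) (by positivity) two_ne_zero).mp (e'.trans ?_)
    rw [hk, hl, zpow_add₀ p₁.ne', zpow_add₀ p₂.ne']
    ring
  · intro a b c e
    have e' : ε₁ ^ (2 * a + α * c) * ε₂ ^ (2 * b + β * c) * ε₃ ^ c = 1 := by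
      have := congrArg (· ^ 2) e
      simp only [mul_pow, hpow, one_pow] at this
      rw [two_mul, two_mul, zpow_add₀ p₁.ne', zpow_add₀ p₁.ne', zpow_add₀ p₂.ne',
        zpow_add₀ p₂.ne', ← this]
      ring
    obtain ⟨h1, h2, rfl⟩ := h.indep e'
    refine ⟨by omega, by omega, rfl⟩

theorem isRealFSU_of_even (h : QuadraticUnits q r ε₁ ε₂ ε₃)
    (hpar : ∀ a b c : ℤ, (∃ w ∈ RealBiquadratic q r, w ^ 2 = ε₁ ^ a * ε₂ ^ b * ε₃ ^ c) →
      Even a ∧ Even b ∧ Even c) :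
    IsRealFSU q r ε₁ ε₂ ε₃ := by
  obtain ⟨p₁, p₂, p₃⟩ := h.pos
  refine ⟨h.pos, h.mem, ⟨h.left.mem.2, h.right.mem.2, h.mul.mem.2⟩, ?_, fun _ _ _ => h.indep⟩
  intro z hz hu hpos
  obtain ⟨a, b, c, e⟩ := h.exists_sq_eq hz hu
  obtain ⟨⟨k, hk⟩, ⟨l, hl⟩, ⟨n, hn⟩⟩ := hpar a b c ⟨z, hz, e⟩
  refine ⟨k, l, n, (pow_left_inj₀ (by positivity) (by positivity) two_ne_zero).mp (e.trans ?_)⟩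
  rw [hk, hl, hn, zpow_add₀ p₁.ne', zpow_add₀ p₂.ne', zpow_add₀ p₃.ne']
  ring

end QuadraticUnits

/-! ### Square classes of units of norm one -/

/-- Coprimality splits `m = gcd(m, U) · gcd(m, V)`. After cancelling these factors the cofactors of
`U` and `V` are coprime with product `s²`, so each is a square. -/
theorem Nat.exists_eq_mul_sq_of_coprime {U V m s : ℕ} (hm : m ≠ 0) (h : Nat.Coprime U V)
    (e : U * V = m * s ^ 2) : ∃ g k : ℕ, g ∣ m ∧ U = g * k ^ 2 := by
  have hg : m = Nat.gcd m U * Nat.gcd m V := by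
    rw [← Nat.Coprime.gcd_mul m h, e, Nat.gcd_eq_left (dvd_mul_right m _)]
  obtain ⟨u, hu⟩ := Nat.gcd_dvd_right m U
  obtain ⟨v, hv⟩ := Nat.gcd_dvd_right m V
  have huv : u * v = s ^ 2 := by
    apply Nat.eq_of_mul_eq_mul_left (Nat.pos_of_ne_zero hm)
    calc m * (u * v) = Nat.gcd m U * u * (Nat.gcd m V * v) := by
          nth_rw 1 [hg]
          ring
      _ = m * s ^ 2 := by rw [← hu, ← hv, e]
  have hcop : IsCoprime (u : ℤ) v := by
    rw [Nat.isCoprime_iff_coprime]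
    exact (h.coprime_dvd_left ⟨_, by rw [mul_comm]; exact hu⟩).coprime_dvd_right
      ⟨_, by rw [mul_comm]; exact hv⟩
  obtain ⟨k, hk⟩ := Int.sq_of_isCoprime hcop (c := (s : ℤ)) (by exact_mod_cast huv)
  refine ⟨Nat.gcd m U, k.natAbs, Nat.gcd_dvd_left m U, ?_⟩
  have hk' : u = k.natAbs ^ 2 := by
    zify
    rw [sq_abs]
    rcases hk with hk | hk
    · exact hk
    · have : (0 : ℤ) ≤ u := Int.natCast_nonneg u
      nlinarith [sq_nonneg k]
  rw [← hk']
  exact hu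

/-- `z` is the square of an element of `F`. -/
def IsSquareIn (F : IntermediateField ℚ ℝ) (z : ℝ) : Prop := ∃ w ∈ F, w ^ 2 = z

namespace IsSquareIn

variable {F E : IntermediateField ℚ ℝ} {z w : ℝ}

theorem mono (h : IsSquareIn E z) (hEF : E ≤ F) : IsSquareIn F z :=
  let ⟨w, hw, e⟩ := h
  ⟨w, hEF hw, e⟩

theorem sq (hz : z ∈ F) : IsSquareIn F (z ^ 2) := ⟨z, hz, rfl⟩

theorem mul (hz : IsSquareIn F z) (hw : IsSquareIn F w) : IsSquareIn F (z * w) := by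
  obtain ⟨x, hx, rfl⟩ := hz
  obtain ⟨y, hy, rfl⟩ := hw
  exact ⟨x * y, mul_mem hx hy, mul_pow x y 2⟩

theorem div (hz : IsSquareIn F z) (hw : IsSquareIn F w) : IsSquareIn F (z / w) := by
  obtain ⟨x, hx, rfl⟩ := hz
  obtain ⟨y, hy, rfl⟩ := hw
  exact ⟨x / y, div_mem hx hy, div_pow x y 2⟩

theorem zpow (hz : IsSquareIn F z) (n : ℤ) : IsSquareIn F (z ^ n) := by
  obtain ⟨x, hx, rfl⟩ := hz
  exact ⟨x ^ n, zpow_mem hx n, by rw [← zpow_natCast, zpow_comm, zpow_natCast]⟩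

theorem even_zpow (hz : z ∈ F) {n : ℤ} (hn : Even n) : IsSquareIn F (z ^ n) := by
  obtain ⟨k, rfl⟩ := hn
  rw [← two_mul, zpow_mul]
  exact (sq hz).zpow k

theorem sqrt_mem (hz : IsSquareIn F z) : √z ∈ F := by
  obtain ⟨w, hw, rfl⟩ := hz
  rw [Real.sqrt_sq_eq_abs]
  rcases abs_choice w with h | h <;> rw [h]
  · exact hw
  · exact neg_mem hw

theorem of_ratCast {c : ℚ} (h : IsSquare c) : IsSquareIn F c := by
  obtain ⟨x, rfl⟩ := h
  exact ⟨x, IntermediateField.algebraMap_mem F x, by push_cast; ring⟩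

end IsSquareIn

theorem isSquareIn_natCast_self (m : ℕ) : IsSquareIn (RealQuadratic m) m :=
  ⟨√(m : ℝ), IntermediateField.mem_adjoin_simple_self ℚ _, Real.sq_sqrt (Nat.cast_nonneg m)⟩

section NormOne

variable {m : ℕ} {ε : ℝ} {a b : ℚ}

/-- Here `ε⁻¹` is the conjugate of `ε`, so `(1 + ε)² = ε(ε + ε⁻¹ + 2)` with `ε + ε⁻¹ = 2a`. -/
theorem one_add_sq_eq (hε : ε = a + b * √(m : ℝ)) (hN : a ^ 2 - m * b ^ 2 = 1) :
    (1 + ε) ^ 2 = ε * ((2 * a + 2 : ℚ) : ℝ) := by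
  have hs : √(m : ℝ) ^ 2 = m := Real.sq_sqrt (Nat.cast_nonneg m)
  have hN' : (a : ℝ) ^ 2 - m * b ^ 2 = 1 := by exact_mod_cast hN
  rw [hε]
  push_cast
  linear_combination b ^ 2 * hs - hN'

theorem one_lt_of_norm_eq_one (h1 : 1 < ε) (hε : ε = a + b * √(m : ℝ))
    (hN : a ^ 2 - m * b ^ 2 = 1) : 1 < a := by
  have h := one_add_sq_eq hε hN
  push_cast at h
  have : (1 : ℝ) < a := by
    by_contra hle
    push Not at hle
    nlinarith [mul_nonneg (zero_le_one.trans h1.le) (sub_nonneg.mpr hle), sq_nonneg (ε - 1),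
      mul_pos (sub_pos.mpr h1) (sub_pos.mpr h1)]
  exact_mod_cast this

/-- A unit `a + b√m > 1` of norm `1` agrees with `2a + 2` up to squares. -/
theorem isSquareIn_mul_of_norm_eq_one {F : IntermediateField ℚ ℝ} (h1 : 1 < ε) (hF : ε ∈ F)
    (hε : ε = a + b * √(m : ℝ)) (hN : a ^ 2 - m * b ^ 2 = 1) {c : ℝ} :
    IsSquareIn F (ε * c) ↔ IsSquareIn F ((2 * a + 2 : ℚ) * c) := by
  have h := one_add_sq_eq hε hN
  have hpos : (0 : ℝ) < (2 * a + 2 : ℚ) := by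
    have := one_lt_of_norm_eq_one h1 hε hN
    exact_mod_cast (by linarith : (0 : ℚ) < 2 * a + 2)
  have hsq : IsSquareIn F (ε * (2 * a + 2 : ℚ)) := h ▸ IsSquareIn.sq (add_mem (one_mem F) hF)
  have hm : ((2 * a + 2 : ℚ) : ℝ) ∈ F := IntermediateField.algebraMap_mem F _
  have hε0 : ε ≠ 0 := by positivity
  generalize ((2 * a + 2 : ℚ) : ℝ) = t at *
  have ht := hpos.ne'
  constructor <;> intro hc
  · convert (hc.mul hsq).div (IsSquareIn.sq hF) using 1
    field_simp
  · convert (hc.mul hsq).div (IsSquareIn.sq hm) using 1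
    field_simp

/-- Otherwise `ε` would be a square in its own quadratic field. This excludes the trivial
factorisations of `a² - 1 = m b²` below. -/
theorem IsFundamentalUnit.not_isSquare_of_norm_eq_one (h : IsFundamentalUnit m ε)
    (hε : ε = a + b * √(m : ℝ)) (hN : a ^ 2 - m * b ^ 2 = 1) :
    ¬ IsSquareIn (RealQuadratic m) ((2 * a + 2 : ℚ) : ℝ) := by
  intro hsq
  obtain ⟨w, hw, e⟩ : IsSquareIn (RealQuadratic m) (ε * 1) :=
    (isSquareIn_mul_of_norm_eq_one h.1 h.mem.1 hε hN).mpr (by simpa using hsq)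
  exact h.ne_sq hw (by rw [e, mul_one])

end NormOne

theorem Int.even_and_even_of_four_dvd {A B : ℤ} (h : (4 : ℤ) ∣ A ^ 2 + B ^ 2) :
    Even A ∧ Even B := by
  rcases Int.even_or_odd' A with ⟨k, rfl | rfl⟩ <;> rcases Int.even_or_odd' B with ⟨l, rfl | rfl⟩
  · simp
  all_goals ring_nf at h; omega

/-- A unit of `ℚ(√m)` with `m ≡ 3 mod 4` has integral coefficients and norm `1`. -/
theorem exists_int_of_mod_four_eq_three {m : ℕ} (hm : m % 4 = 3) {a b : ℚ}
    (hAB : ∃ A B : ℤ, 2 * a = A ∧ 2 * b = B)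
    (hN : a ^ 2 - m * b ^ 2 = 1 ∨ a ^ 2 - m * b ^ 2 = -1) :
    (∃ k l : ℤ, a = k ∧ b = l) ∧ a ^ 2 - m * b ^ 2 = 1 := by
  obtain ⟨A, B, hA, hB⟩ := hAB
  obtain ⟨n, hn⟩ : ∃ n : ℤ, (m : ℤ) = 4 * n - 1 := ⟨m / 4 + 1, by omega⟩
  have hmq : (m : ℚ) = 4 * n - 1 := by exact_mod_cast hn
  -- As `m ≡ -1` modulo `4`, the equation `A² - mB² = ±4` becomes `A² + B² ≡ 0`.
  have h4 : (4 : ℤ) ∣ A ^ 2 + B ^ 2 := by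
    rcases hN with hN | hN
    · refine ⟨1 + n * B ^ 2, ?_⟩
      have : (A : ℚ) ^ 2 + B ^ 2 = 4 * (1 + n * B ^ 2) := by
        rw [← hA, ← hB]; rw [hmq] at hN; linear_combination 4 * hN
      exact_mod_cast this
    · refine ⟨-1 + n * B ^ 2, ?_⟩
      have : (A : ℚ) ^ 2 + B ^ 2 = 4 * (-1 + n * B ^ 2) := by
        rw [← hA, ← hB]; rw [hmq] at hN; linear_combination 4 * hN
      exact_mod_cast this
  obtain ⟨⟨k, rfl⟩, ⟨l, rfl⟩⟩ := Int.even_and_even_of_four_dvd h4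
  have ha : a = k := by push_cast at hA; linarith
  have hb : b = l := by push_cast at hB; linarith
  refine ⟨⟨k, l, ha, hb⟩, hN.resolve_right fun hN => ?_⟩
  -- Norm `-1` would make a sum of two squares congruent to `3` modulo `4`.
  have h5 : k ^ 2 + l ^ 2 = 4 * (n * l ^ 2) - 1 := by
    have : (k : ℚ) ^ 2 + l ^ 2 = 4 * (n * l ^ 2) - 1 := by
      rw [← ha, ← hb]; rw [hmq] at hN; linear_combination hN
    exact_mod_cast this
  rcases Int.even_or_odd' k with ⟨i, rfl | rfl⟩ <;>
    rcases Int.even_or_odd' l with ⟨j, rfl | rfl⟩ <;> ring_nf at h5 <;> omega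

/-- Factor `k² - 1 = q l²`. If `k` is odd, `(k + 1)/2` and `(k - 1)/2` are coprime, so `2k + 2` is a
square times a divisor of `q`, hence a square in `ℚ(√q)`, which is impossible. So `k` is even, `k +
1` and `k - 1` are coprime, and it is `2(2k + 2)` that is a square there. -/
theorem IsFundamentalUnit.exists_isSquareIn_mul_two {q : ℕ} {ε : ℝ} (hq : q.Prime)
    (hq4 : q % 4 = 3) (h : IsFundamentalUnit q ε) : IsSquareIn (RealQuadratic q) (ε * 2) := by
  obtain ⟨a, b, hε, hAB, hN⟩ := h.exists_coeffs hq.prime.squarefree hq.ne_one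
  obtain ⟨⟨k, l, rfl, rfl⟩, hN⟩ := exists_int_of_mod_four_eq_three hq4 hAB hN
  have hk : 1 < k := by exact_mod_cast one_lt_of_norm_eq_one h.1 hε hN
  have hsq := h.not_isSquare_of_norm_eq_one hε hN
  rw [isSquareIn_mul_of_norm_eq_one h.1 h.mem.1 hε hN]
  obtain ⟨n, rfl⟩ := Int.eq_ofNat_of_zero_le (by omega : 0 ≤ k)
  have hdiv {g j : ℕ} (hg : g ∣ q) : IsSquareIn (RealQuadratic q) ((4 * (g * j ^ 2) : ℕ) : ℝ) := by
    have h4 : IsSquareIn (RealQuadratic q) (((2 * j) ^ 2 : ℚ) : ℝ) :=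
      IsSquareIn.of_ratCast ⟨2 * j, by ring⟩
    rcases (Nat.dvd_prime hq).mp hg with rfl | rfl
    · convert h4 using 1; push_cast; ring
    · convert (isSquareIn_natCast_self g).mul h4 using 1; push_cast; ring
  have hNn : n ^ 2 = q * l.natAbs ^ 2 + 1 := by
    zify
    rw [sq_abs]
    have : (n : ℚ) ^ 2 = q * l ^ 2 + 1 := by push_cast at hN; linarith
    exact_mod_cast this
  generalize l.natAbs = y at hNn
  rcases Nat.even_or_odd' n with ⟨i, rfl | rfl⟩
  · obtain ⟨g, j, hg, e⟩ := Nat.exists_eq_mul_sq_of_coprime (U := 2 * i + 1) (V := 2 * i - 1)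
      (m := q) (s := y) hq.ne_zero (by
        obtain ⟨t, rfl⟩ : ∃ t, i = t + 1 := ⟨i - 1, by omega⟩
        rw [show 2 * (t + 1) - 1 = 2 * t + 1 by omega,
          show 2 * (t + 1) + 1 = 2 * t + 1 + 2 by omega, Nat.coprime_self_add_left]
        simp) (by
        obtain ⟨t, rfl⟩ : ∃ t, i = t + 1 := ⟨i - 1, by omega⟩
        rw [show 2 * (t + 1) - 1 = 2 * t + 1 by omega]
        linarith)
    convert hdiv (j := j) hg using 1
    rw [← e]; push_cast; ring
  · exfalso
    apply hsq
    obtain ⟨y', rfl⟩ : ∃ y', y = 2 * y' := by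
      have hev : Even (q * y ^ 2) := ⟨2 * i ^ 2 + 2 * i, by linarith⟩
      rw [Nat.even_mul, Nat.even_pow' two_ne_zero] at hev
      rcases hev with hev | hev
      · exact absurd hev (by rw [Nat.not_even_iff]; omega)
      · obtain ⟨t, rfl⟩ := hev
        exact ⟨t, by ring⟩
    obtain ⟨g, j, hg, e⟩ := Nat.exists_eq_mul_sq_of_coprime (U := i + 1) (V := i)
      (m := q) (s := y') hq.ne_zero (by simp) (by linarith)
    convert hdiv (j := j) hg using 1
    rw [← e]; push_cast; ring

/-- Coprime factorisation shows that `2a + 2` is a rational square times a divisor `g` of `p₁p₂`.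
The values `g = 1` and `g = p₁p₂` would make it a square in `ℚ(√(p₁p₂))`; the remaining `p₁` and
`p₂` have the same class there. -/
theorem IsFundamentalUnit.exists_isSquareIn_mul_prime {p₁ p₂ : ℕ} {ε : ℝ} (hp₁ : p₁.Prime)
    (hp₂ : p₂.Prime) (h4 : p₁ * p₂ % 4 = 1) (h : IsFundamentalUnit (p₁ * p₂) ε)
    {a b : ℚ} (hε : ε = a + b * √((p₁ * p₂ : ℕ) : ℝ)) (hN : a ^ 2 - (p₁ * p₂ : ℕ) * b ^ 2 = 1)
    (hAB : ∃ A B : ℤ, 2 * a = A ∧ 2 * b = B) :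
    IsSquareIn (RealQuadratic (p₁ * p₂)) (ε * p₁) := by
  have hk := one_lt_of_norm_eq_one h.1 hε hN
  have hsq := h.not_isSquare_of_norm_eq_one hε hN
  rw [isSquareIn_mul_of_norm_eq_one h.1 h.mem.1 hε hN]
  obtain ⟨A, B, hA, hB⟩ := hAB
  have hA2 : 2 < A := by
    have : (2 : ℚ) < A := by rw [← hA]; linarith
    exact_mod_cast this
  have hm0 : p₁ * p₂ ≠ 0 := mul_ne_zero hp₁.ne_zero hp₂.ne_zero
  obtain ⟨n, rfl⟩ := Int.eq_ofNat_of_zero_le (by omega : 0 ≤ A)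
  have hdiv {g : ℕ} {j : ℚ} (hg : g ∣ p₁ * p₂) (e : 2 * a + 2 = g * j ^ 2) :
      IsSquareIn (RealQuadratic (p₁ * p₂)) ((2 * a + 2 : ℚ) * p₁) := by
    have hj : IsSquareIn (RealQuadratic (p₁ * p₂)) ((j ^ 2 : ℚ) : ℝ) :=
      IsSquareIn.of_ratCast ⟨j, by ring⟩
    have hself := isSquareIn_natCast_self (p₁ * p₂)
    obtain ⟨g₁, g₂, hg₁, hg₂, rfl⟩ := Nat.dvd_mul.mp hg
    rcases (Nat.dvd_prime hp₁).mp hg₁ with rfl | rfl <;>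
      rcases (Nat.dvd_prime hp₂).mp hg₂ with rfl | rfl
    · exact absurd (by rw [e]; simpa using hj) hsq
    · rw [e]; convert hself.mul hj using 1; push_cast; ring
    · rw [e]
      convert (IsSquareIn.of_ratCast ⟨(g₁ : ℚ), rfl⟩).mul hj using 1; push_cast; ring
    · exact absurd (by rw [e]; convert hself.mul hj using 1; push_cast; ring) hsq
  have hNn : n ^ 2 = p₁ * p₂ * B.natAbs ^ 2 + 4 := by
    zify
    rw [sq_abs]
    have : (n : ℚ) ^ 2 = p₁ * p₂ * B ^ 2 + 4 := by
      have hA' : (n : ℚ) = 2 * a := by rw [hA]; rfl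
      rw [hA', ← hB]; push_cast at hN; linarith
    exact_mod_cast this
  have hA' : 2 * a = n := hA
  generalize B.natAbs = y at hNn
  have hodd : ¬ Even (p₁ * p₂) := by rw [Nat.not_even_iff]; omega
  have half {x k : ℕ} (e : p₁ * p₂ * x ^ 2 = 2 * k) : ∃ x', x = 2 * x' := by
    have hev : Even (p₁ * p₂ * x ^ 2) := ⟨k, by linarith⟩
    rw [Nat.even_mul, Nat.even_pow' two_ne_zero] at hev
    obtain ⟨t, rfl⟩ := hev.resolve_left hodd
    exact ⟨t, by ring⟩
  -- With `n = 2a` odd, `n + 2` and `n - 2` are coprime. With `n` even, `a` is an integer: even `a`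
  -- is impossible modulo `4`, and for odd `a` the coprime factors are `(a + 1)/2` and `(a - 1)/2`.
  rcases Nat.even_or_odd' n with ⟨i, rfl | rfl⟩
  · obtain ⟨x, rfl⟩ := half (x := y) (k := 2 * i ^ 2 - 2) (by
      have : 4 * i ^ 2 = p₁ * p₂ * y ^ 2 + 4 := by linarith
      omega)
    have hi : i ^ 2 = p₁ * p₂ * x ^ 2 + 1 := by linarith
    rcases Nat.even_or_odd' i with ⟨t, rfl | rfl⟩
    · exfalso
      obtain ⟨c, hc⟩ : ∃ c, p₁ * p₂ = 4 * c + 1 := ⟨p₁ * p₂ / 4, by omega⟩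
      rw [hc] at hi
      rcases Nat.even_or_odd' x with ⟨u, rfl | rfl⟩ <;> ring_nf at hi <;> omega
    · obtain ⟨x', rfl⟩ := half (x := x) (k := 2 * t ^ 2 + 2 * t) (by linarith)
      obtain ⟨g, j, hg, e⟩ := Nat.exists_eq_mul_sq_of_coprime (U := t + 1) (V := t)
        (m := p₁ * p₂) (s := x') hm0 (by simp) (by linarith)
      refine hdiv (j := 2 * j) hg ?_
      have e' : (t : ℚ) + 1 = g * j ^ 2 := by exact_mod_cast e
      rw [hA']; push_cast; linear_combination 4 * e'
  · obtain ⟨t, rfl⟩ : ∃ t, i = t + 1 := ⟨i - 1, by omega⟩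
    obtain ⟨g, j, hg, e⟩ := Nat.exists_eq_mul_sq_of_coprime (U := 2 * t + 1 + 4)
      (V := 2 * t + 1) (m := p₁ * p₂) (s := y) hm0 (by
        rw [Nat.coprime_self_add_left, show 4 = 2 ^ 2 from rfl]
        exact Nat.Coprime.pow_left 2 (by simp)) (by linarith)
    refine hdiv (j := j) hg ?_
    have e' : 2 * (t : ℚ) + 1 + 4 = g * j ^ 2 := by exact_mod_cast e
    rw [hA']; push_cast; linear_combination e'

/-! ### Square classes of rational numbers in the biquadratic field -/

theorem IsBiquadraticPair.isSquare_of_isSquareIn {q r : ℕ} (h : IsBiquadraticPair q r) {c : ℚ}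
    (hc : IsSquareIn (RealBiquadratic q r) c) :
    IsSquare c ∨ IsSquare (c * q) ∨ IsSquare (c * r) ∨ IsSquare (c * (r * q)) := by
  obtain ⟨σ, τ, hστ⟩ := h.exists_isConjPair
  obtain ⟨w, hw, e⟩ := hc
  exact hστ.isSquare_of_sq_eq (w := ⟨w, hw⟩) (Subtype.ext (by push_cast; exact e))

theorem not_isSquare_rat_of_mod_four_eq_two {n : ℕ} (hn : n % 4 = 2) : ¬ IsSquare (n : ℚ) := by
  rw [Rat.isSquare_natCast_iff]
  rintro ⟨k, rfl⟩
  rcases Nat.even_or_odd' k with ⟨t, rfl | rfl⟩ <;> ring_nf at hn <;> omega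

theorem isSquareIn_left (q r : ℕ) : IsSquareIn (RealBiquadratic q r) q :=
  (isSquareIn_natCast_self q).mono (realQuadratic_left_le q r)

theorem isSquareIn_right (q r : ℕ) : IsSquareIn (RealBiquadratic q r) r :=
  (isSquareIn_natCast_self r).mono (realQuadratic_right_le q r)

/-- Multiplying `2c` by any of `1`, `q`, `r`, `rq` leaves it congruent to `2` modulo `4`, so it is
never a square. -/
theorem not_isSquareIn_two_mul {q r c : ℕ} (h : IsBiquadraticPair q r) (hq : Odd q) (hr : Odd r)
    (hc : Odd c) : ¬ IsSquareIn (RealBiquadratic q r) (2 * c) := by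
  intro hsq
  have hn {n : ℕ} (hn : Odd n) : ¬ IsSquare ((2 * n : ℕ) : ℚ) := by
    obtain ⟨k, rfl⟩ := hn
    exact not_isSquare_rat_of_mod_four_eq_two (by omega)
  rcases h.isSquare_of_isSquareIn (c := 2 * c) (by push_cast; exact hsq) with h' | h' | h' | h'
  · exact hn hc (by push_cast; exact h')
  · exact hn (hc.mul hq) (by push_cast; rwa [← mul_assoc])
  · exact hn (hc.mul hr) (by push_cast; rwa [← mul_assoc])
  · exact hn (hc.mul (hr.mul hq)) (by push_cast; rwa [← mul_assoc])

/-- Up to the factor `p₁²`, the four candidates are `p₁`, `p₁q`, `p₂`, `p₂q`: squarefree and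
different from `1`. -/
theorem not_isSquareIn_prime {p₁ p₂ q : ℕ} (hp₁ : p₁.Prime) (hp₂ : p₂ ≠ 1) (hq : q ≠ 1)
    (hsf : Squarefree (p₁ * p₂ * q)) (h : IsBiquadraticPair q (p₁ * p₂)) :
    ¬ IsSquareIn (RealBiquadratic q (p₁ * p₂)) p₁ := by
  intro hsq
  have hn {n : ℕ} (hn : n ∣ p₁ * p₂ * q) (h1 : n ≠ 1) : ¬ IsSquare (n : ℚ) :=
    Nat.not_isSquare_rat_of_squarefree (hsf.squarefree_of_dvd hn) h1
  have hp0 : (p₁ : ℚ) ≠ 0 := by exact_mod_cast hp₁.ne_zero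
  have hcancel {x : ℚ} (hx : IsSquare (p₁ * (p₁ * x))) : IsSquare x := by
    have := hx.div (IsSquare.mul_self (p₁ : ℚ))
    rwa [← mul_assoc, mul_div_cancel_left₀ x (mul_ne_zero hp0 hp0)] at this
  rcases h.isSquare_of_isSquareIn (c := p₁) (by exact_mod_cast hsq) with h' | h' | h' | h'
  · exact hn ⟨p₂ * q, by ring⟩ hp₁.ne_one h'
  · exact hn (n := p₁ * q) ⟨p₂, by ring⟩
      (fun e => hp₁.ne_one (Nat.eq_one_of_mul_eq_one_right e)) (by exact_mod_cast h')
  · exact hn ⟨p₁ * q, by ring⟩ hp₂ (hcancel (by push_cast at h'; exact h'))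
  · refine hn (n := p₂ * q) ⟨p₁, by ring⟩ (fun e => hq (Nat.eq_one_of_mul_eq_one_left e)) ?_
    push_cast at h' ⊢
    exact hcancel (by rwa [mul_assoc] at h')

/-- In an intermediate field where `a`, `b` and `a b` are not squares, `a ^ m * b ^ n` is a square
only for even `m` and `n`. -/
theorem even_of_isSquareIn_zpow_mul {F : IntermediateField ℚ ℝ} {a b : ℝ} (ha : a ∈ F) (hb : b ∈ F)
    (ha0 : a ≠ 0) (hb0 : b ≠ 0) (h₁ : ¬ IsSquareIn F a) (h₂ : ¬ IsSquareIn F b)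
    (h₃ : ¬ IsSquareIn F (a * b)) {m n : ℤ} (h : IsSquareIn F (a ^ m * b ^ n)) :
    Even m ∧ Even n := by
  rcases Int.even_or_odd' m with ⟨k, hm⟩
  rcases Int.even_or_odd' n with ⟨l, hn⟩
  have ea : IsSquareIn F (a ^ (2 * k)) := .even_zpow ha (even_two_mul k)
  have eb : IsSquareIn F (b ^ (2 * l)) := .even_zpow hb (even_two_mul l)
  have hA := (zpow_ne_zero (2 * k) ha0)
  have hB := (zpow_ne_zero (2 * l) hb0)
  have key := h.div (ea.mul eb)
  rcases hm with rfl | rfl <;> rcases hn with rfl | rfl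
  · exact ⟨even_two_mul k, even_two_mul l⟩
  · exact absurd (by convert key using 1; rw [zpow_add_one₀ hb0]; field_simp) h₂
  · exact absurd (by convert key using 1; rw [zpow_add_one₀ ha0]; field_simp) h₁
  · exact absurd (by
      convert key using 1
      rw [zpow_add_one₀ ha0, zpow_add_one₀ hb0]; field_simp) h₃

/-- Replacing `u` by `c` in the same square class. -/
theorem IsSquareIn.zpow_congr {F : IntermediateField ℚ ℝ} {u c z : ℝ} (hu : u ≠ 0)
    (h : IsSquareIn F (u * c)) {n : ℤ} (hz : IsSquareIn F (u ^ n * z)) :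
    IsSquareIn F (c ^ n * z⁻¹) := by
  rcases eq_or_ne z 0 with rfl | hz0
  · exact ⟨0, zero_mem F, by simp⟩
  convert (h.zpow n).div hz using 1
  rw [mul_zpow]
  have := zpow_ne_zero n hu
  field_simp

/-- The sign is immaterial over `F`: since `(x + 1)(x - 1) = m y²` and `m` is a square in `F`, the
numbers `x + 1` and `x - 1` have the same class. -/
theorem SquarePM.isSquareIn {F : IntermediateField ℚ ℝ} {m c : ℕ} {x y : ℚ}
    (hm : IsSquareIn F m) (hc : c ≠ 0) (hx : 1 < x) (hN : x ^ 2 - m * y ^ 2 = 1)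
    (h : SquarePM c x) : IsSquareIn F (c * ((x : ℝ) + 1)) := by
  rcases h with ⟨n, hn⟩ | ⟨n, hn⟩
  · have : ((c * (x + 1) : ℚ) : ℝ) = c * ((x : ℝ) + 1) := by push_cast; rfl
    rw [← this]
    exact IsSquareIn.of_ratCast ⟨n, by rw [hn, sq]⟩
  · have h1 : IsSquareIn F ((c * (x - 1) : ℚ) : ℝ) := IsSquareIn.of_ratCast ⟨n, by rw [hn, sq]⟩
    have h2 : IsSquareIn F (((c * y) ^ 2 : ℚ) : ℝ) := IsSquareIn.of_ratCast ⟨c * y, by ring⟩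
    convert (hm.mul h2).div h1 using 1
    have hx' : (x : ℝ) - 1 ≠ 0 := by
      have : (1 : ℝ) < x := by exact_mod_cast hx
      linarith
    have hc' : (c : ℝ) ≠ 0 := by exact_mod_cast hc
    have hN' : (x : ℝ) ^ 2 - m * y ^ 2 = 1 := by exact_mod_cast hN
    push_cast
    rw [eq_div_iff (mul_ne_zero hc' hx')]
    linear_combination c ^ 2 * hN'

/-- Conversely, a rational square `c (x + 1)` or `c (x - 1)` with integral `x` gives `SquarePM`. -/
theorem isSquareInNat_of_isSquare {c : ℕ} {k : ℤ} (hk : 0 ≤ k) (h : IsSquare ((c : ℚ) * k)) :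
    IsSquareInNat (c * k) := by
  obtain ⟨n, rfl⟩ := Int.eq_ofNat_of_zero_le hk
  have h' : IsSquare ((c * n : ℕ) : ℚ) := by push_cast; exact h
  obtain ⟨j, hj⟩ := Rat.isSquare_natCast_iff.mp h'
  refine ⟨j, ?_⟩
  rw [sq]
  exact_mod_cast hj

/-! ### Which monomials in the quadratic units are squares -/

/-- Primes `p₁ ≠ p₂` congruent to `1` and `q` congruent to `3` modulo `4`. -/
structure PrimeTriple (p₁ p₂ q : ℕ) : Prop where
  prime₁ : p₁.Prime
  prime₂ : p₂.Prime
  prime : q.Prime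
  ne : p₁ ≠ p₂
  mod₁ : p₁ % 4 = 1
  mod₂ : p₂ % 4 = 1
  mod : q % 4 = 3

namespace PrimeTriple

variable {p₁ p₂ q : ℕ} {ε₁ ε₂ ε₃ : ℝ}

theorem squarefree (h : PrimeTriple p₁ p₂ q) : Squarefree (p₁ * p₂ * q) := by
  have h12 : Nat.Coprime p₁ p₂ := (Nat.coprime_primes h.prime₁ h.prime₂).mpr h.ne
  have h1q : Nat.Coprime p₁ q :=
    (Nat.coprime_primes h.prime₁ h.prime).mpr fun e => by have := h.mod₁; have := h.mod; omega
  have h2q : Nat.Coprime p₂ q :=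
    (Nat.coprime_primes h.prime₂ h.prime).mpr fun e => by have := h.mod₂; have := h.mod; omega
  rw [Nat.squarefree_mul (h1q.mul_left h2q), Nat.squarefree_mul h12]
  exact ⟨⟨h.prime₁.prime.squarefree, h.prime₂.prime.squarefree⟩, h.prime.prime.squarefree⟩

theorem mul_ne_one (h : PrimeTriple p₁ p₂ q) : p₁ * p₂ ≠ 1 :=
  fun e => h.prime₁.ne_one (Nat.eq_one_of_mul_eq_one_right e)

theorem mul_mod (h : PrimeTriple p₁ p₂ q) : p₁ * p₂ % 4 = 1 := by
  rw [Nat.mul_mod, h.mod₁, h.mod₂]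

theorem mul_mul_mod (h : PrimeTriple p₁ p₂ q) : p₁ * p₂ * q % 4 = 3 := by
  rw [Nat.mul_mod, h.mul_mod, h.mod]

theorem odd₁ (h : PrimeTriple p₁ p₂ q) : Odd p₁ := Nat.odd_iff.mpr (by have := h.mod₁; omega)

theorem odd_mul (h : PrimeTriple p₁ p₂ q) : Odd (p₁ * p₂) :=
  Nat.odd_iff.mpr (by have := h.mul_mod; omega)

theorem odd (h : PrimeTriple p₁ p₂ q) : Odd q := Nat.odd_iff.mpr (by have := h.mod; omega)

theorem isBiquadraticPair (h : PrimeTriple p₁ p₂ q) : IsBiquadraticPair q (p₁ * p₂) :=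
  ⟨Nat.not_isSquare_rat_of_squarefree h.prime.prime.squarefree h.prime.ne_one,
    Nat.not_isSquare_rat_of_squarefree
      (h.squarefree.squarefree_of_dvd (dvd_mul_right _ _)) h.mul_ne_one,
    Nat.not_isSquare_rat_of_squarefree h.squarefree
      fun e => h.prime.ne_one (Nat.eq_one_of_mul_eq_one_left e)⟩

theorem not_isSquareIn_two (h : PrimeTriple p₁ p₂ q) :
    ¬ IsSquareIn (RealBiquadratic q (p₁ * p₂)) 2 := by
  have := not_isSquareIn_two_mul (c := 1) h.isBiquadraticPair h.odd h.odd_mul odd_one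
  rwa [Nat.cast_one, mul_one] at this

end PrimeTriple

theorem natCast_mem_intermediateField (F : IntermediateField ℚ ℝ) (n : ℕ) : (n : ℝ) ∈ F := by
  simp

namespace QuadraticUnits

variable {p₁ p₂ q : ℕ} {ε₁ ε₂ ε₃ : ℝ}

theorem isSquareIn_left_mul_two (H : QuadraticUnits q (p₁ * p₂) ε₁ ε₂ ε₃)
    (h : PrimeTriple p₁ p₂ q) : IsSquareIn (RealBiquadratic q (p₁ * p₂)) (ε₁ * 2) :=
  (H.left.exists_isSquareIn_mul_two h.prime h.mod).mono (realQuadratic_left_le _ _)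

theorem isSquareIn_right_mul_prime (H : QuadraticUnits q (p₁ * p₂) ε₁ ε₂ ε₃)
    (h : PrimeTriple p₁ p₂ q) (hN : HasQuadraticNorm (p₁ * p₂) ε₂ 1) :
    IsSquareIn (RealBiquadratic q (p₁ * p₂)) (ε₂ * p₁) := by
  obtain ⟨a, b, hab, hAB, -⟩ := H.right.exists_coeffs H.squarefree_right H.right_ne
  have := (hab ▸ hN).eq H.isBiquadraticPair.right
  exact (H.right.exists_isSquareIn_mul_prime h.prime₁ h.prime₂ h.mul_mod hab this.symm
    hAB).mono (realQuadratic_right_le _ _)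

/-- Modulo squares `ε₁` is `2` and `ε₂` is `p₁`, and none of `2`, `p₁`, `2p₁` is a square. -/
theorem even_of_norm_eq_one (H : QuadraticUnits q (p₁ * p₂) ε₁ ε₂ ε₃)
    (h : PrimeTriple p₁ p₂ q) (hN : HasQuadraticNorm (p₁ * p₂) ε₂ 1) {a b : ℤ}
    (hab : IsSquareIn (RealBiquadratic q (p₁ * p₂)) (ε₁ ^ a * ε₂ ^ b)) : Even a ∧ Even b := by
  have hp0 : (p₁ : ℝ) ≠ 0 := by exact_mod_cast h.prime₁.ne_zero
  have h1 := IsSquareIn.zpow_congr H.pos.1.ne' (H.isSquareIn_left_mul_two h) hab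
  -- Each replacement inverts the other factor; the negated exponents have the same parity.
  rw [← zpow_neg, mul_comm ((2 : ℝ) ^ a)] at h1
  have h2 := IsSquareIn.zpow_congr H.pos.2.1.ne' (H.isSquareIn_right_mul_prime h hN) h1
  rw [← zpow_neg, mul_comm ((p₁ : ℝ) ^ (-b))] at h2
  have := even_of_isSquareIn_zpow_mul
    (by exact_mod_cast natCast_mem_intermediateField _ 2) (natCast_mem_intermediateField _ p₁)
    two_ne_zero hp0 h.not_isSquareIn_two (not_isSquareIn_prime h.prime₁ h.prime₂.ne_one
      h.prime.ne_one h.squarefree h.isBiquadraticPair)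
    (not_isSquareIn_two_mul h.isBiquadraticPair h.odd h.odd_mul h.odd₁) h2
  simpa using this

/-- Apply `τ` to the square. It fixes `ε₁`, makes `ε₂` negative because the norm is `-1`, and keeps
`ε₃` positive because the norm of `ε₃` is `1`. A square in `ℝ` is nonnegative, so the exponent of
`ε₂` is even. -/
theorem even_right_of_norm_eq_neg_one (H : QuadraticUnits q (p₁ * p₂) ε₁ ε₂ ε₃)
    (h : PrimeTriple p₁ p₂ q) (hN : HasQuadraticNorm (p₁ * p₂) ε₂ (-1)) {a b c : ℤ}
    (habc : IsSquareIn (RealBiquadratic q (p₁ * p₂)) (ε₁ ^ a * ε₂ ^ b * ε₃ ^ c)) : Even b := by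
  obtain ⟨σ, τ, hστ⟩ := h.isBiquadraticPair.exists_isConjPair
  obtain ⟨m₁, m₂, m₃⟩ := H.mem
  obtain ⟨pos₁, pos₂, pos₃⟩ := H.pos
  obtain ⟨w, hw, e⟩ := habc
  have hconj {m : ℕ} {x y c : ℚ} (hc : x ^ 2 - m * y ^ 2 = c) :
      ((x : ℝ) + y * √(m : ℝ)) * (x - y * √(m : ℝ)) = c := by
    have hs : √(m : ℝ) ^ 2 = m := Real.sq_sqrt (Nat.cast_nonneg m)
    rw [← hc]
    push_cast
    linear_combination -(y : ℝ) ^ 2 * hs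
  have t₁ := coe_map_of_mem_realQuadratic τ (z := ⟨ε₁, m₁⟩) (s := sqrtLeft q (p₁ * p₂)) rfl
    hστ.right_left H.left.mem.1
  have t₂ : (τ ⟨ε₂, m₂⟩ : ℝ) < 0 := by
    obtain ⟨x, y, hxy, -, -⟩ := H.right.exists_coeffs H.squarefree_right H.right_ne
    have hN' := (hxy ▸ hN).eq H.isBiquadraticPair.right
    rw [coe_map_eq_conj τ (z := ⟨ε₂, m₂⟩) (s := sqrtRight q (p₁ * p₂)) rfl hστ.right_right hxy]
    have := hconj hN'.symm
    rw [← hxy] at this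
    refine neg_of_mul_neg_right (a := ε₂) ?_ pos₂.le
    rw [this]
    norm_num
  have t₃ : 0 < (τ ⟨ε₃, m₃⟩ : ℝ) := by
    obtain ⟨x, y, hxy, hAB, hN'⟩ := H.mul.exists_coeffs H.squarefree H.mul_ne
    obtain ⟨-, hN'⟩ := exists_int_of_mod_four_eq_three h.mul_mul_mod hAB hN'
    have hmul : ((sqrtRight q (p₁ * p₂) * sqrtLeft q (p₁ * p₂) : RealBiquadratic q (p₁ * p₂)) : ℝ) =
        √((p₁ * p₂ * q : ℕ) : ℝ) := by
      rw [Nat.cast_mul (p₁ * p₂), Real.sqrt_mul (Nat.cast_nonneg _)]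
      rfl
    rw [coe_map_eq_conj τ (z := ⟨ε₃, m₃⟩) hmul
      (by rw [map_mul, hστ.right_left, hστ.right_right, neg_mul]) hxy]
    have := hconj hN'
    rw [← hxy] at this
    exact pos_of_mul_pos_right (a := ε₃) (by rw [this]; norm_num) pos₃.le
  have e' : (⟨w, hw⟩ : RealBiquadratic q (p₁ * p₂)) ^ 2 =
      ⟨ε₁, m₁⟩ ^ a * ⟨ε₂, m₂⟩ ^ b * ⟨ε₃, m₃⟩ ^ c := Subtype.ext (by push_cast; exact e)
  have e'' := congrArg (fun z => algebraMap (RealBiquadratic q (p₁ * p₂)) ℝ (τ z)) e'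
  simp only [map_mul, map_zpow₀, map_pow, t₁] at e''
  change (τ ⟨w, hw⟩ : ℝ) ^ 2 = ε₁ ^ a * (τ ⟨ε₂, m₂⟩ : ℝ) ^ b * (τ ⟨ε₃, m₃⟩ : ℝ) ^ c at e''
  by_contra hb
  have hneg := (Int.not_even_iff_odd.mp hb).zpow_neg t₂
  have hlt := mul_neg_of_neg_of_pos (mul_neg_of_pos_of_neg (zpow_pos pos₁ a) hneg) (zpow_pos t₃ c)
  rw [← e''] at hlt
  exact absurd (sq_nonneg _) (not_le.mpr hlt)

theorem even_left (H : QuadraticUnits q (p₁ * p₂) ε₁ ε₂ ε₃)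
    (h : PrimeTriple p₁ p₂ q) {a : ℤ}
    (ha : IsSquareIn (RealBiquadratic q (p₁ * p₂)) (ε₁ ^ a)) : Even a := by
  have h1 := IsSquareIn.zpow_congr (z := 1) H.pos.1.ne' (H.isSquareIn_left_mul_two h)
    (by simpa using ha)
  have m2 : (2 : ℝ) ∈ RealBiquadratic q (p₁ * p₂) := by
    exact_mod_cast natCast_mem_intermediateField _ 2
  rcases Int.even_or_odd' a with ⟨k, rfl | rfl⟩
  · exact even_two_mul k
  · refine absurd ?_ h.not_isSquareIn_two
    convert h1.div (.even_zpow m2 (even_two_mul k)) using 1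
    rw [zpow_add_one₀ two_ne_zero]
    have : (2 : ℝ) ^ (2 * k) ≠ 0 := zpow_ne_zero _ two_ne_zero
    field_simp

theorem even_of_norm_eq_neg_one (H : QuadraticUnits q (p₁ * p₂) ε₁ ε₂ ε₃)
    (h : PrimeTriple p₁ p₂ q) (hN : HasQuadraticNorm (p₁ * p₂) ε₂ (-1)) {a b : ℤ}
    (hab : IsSquareIn (RealBiquadratic q (p₁ * p₂)) (ε₁ ^ a * ε₂ ^ b)) : Even a ∧ Even b := by
  have hb : Even b := H.even_right_of_norm_eq_neg_one (a := a) (c := 0) h hN (by simpa using hab)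
  refine ⟨H.even_left h ?_, hb⟩
  convert hab.div (.even_zpow H.mem.2.1 hb) using 1
  have := zpow_ne_zero b H.pos.2.1.ne'
  field_simp

/-- Once `b` is known to be even, an odd `c` would make `ε₃` or `ε₁ε₃` a square, that is, `2(x + 1)`
or `x + 1` would have one of the classes `1`, `q`, `p₁p₂`, `p₁p₂q`. Each of the eight possibilities
contradicts a hypothesis on `x ± 1` or makes `ε₃` a square in its own quadratic field. -/
theorem even_of_not_squarePM (H : QuadraticUnits q (p₁ * p₂) ε₁ ε₂ ε₃)
    (h : PrimeTriple p₁ p₂ q) (hN : HasQuadraticNorm (p₁ * p₂) ε₂ (-1)) {x y : ℚ}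
    (hxy : ε₃ = x + y * √((p₁ * p₂ * q : ℕ) : ℝ)) (h2q : ¬ SquarePM (2 * q) x)
    (h1 : ¬ SquarePM 1 x) (hq : ¬ SquarePM q x) {a b c : ℤ}
    (habc : IsSquareIn (RealBiquadratic q (p₁ * p₂)) (ε₁ ^ a * ε₂ ^ b * ε₃ ^ c)) :
    Even a ∧ Even b ∧ Even c := by
  have hb := H.even_right_of_norm_eq_neg_one h hN habc
  obtain ⟨hAB, hN3⟩ := IsIntegralUnit.exists_int_quadratic H.squarefree H.mul_ne
    (hxy ▸ H.mul.mem.2)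
  obtain ⟨⟨k, l, hk, -⟩, hN3⟩ := exists_int_of_mod_four_eq_three h.mul_mul_mod hAB hN3
  have hx := one_lt_of_norm_eq_one H.mul.1 hxy hN3
  have hk1 : 1 < k := by rw [hk] at hx; exact_mod_cast hx
  have hnot := H.mul.not_isSquare_of_norm_eq_one hxy hN3
  have hac : IsSquareIn (RealBiquadratic q (p₁ * p₂)) (ε₃ ^ c * ε₁ ^ a) := by
    convert habc.div (.even_zpow H.mem.2.1 hb) using 1
    have := zpow_ne_zero b H.pos.2.1.ne'
    field_simp
  have hp0 : (p₁ * p₂ : ℚ) ≠ 0 := by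
    exact_mod_cast mul_ne_zero h.prime₁.ne_zero h.prime₂.ne_zero
  have hq0 : (q : ℚ) ≠ 0 := by exact_mod_cast h.prime.ne_zero
  have hx1 : x + 1 ≠ 0 := by linarith
  have hx1' : x - 1 ≠ 0 := by linarith
  have plus {n : ℕ} (hn : IsSquare (n * (x + 1))) : SquarePM n x := by
    left
    have := isSquareInNat_of_isSquare (c := n) (k := k + 1) (by omega)
      (by push_cast; rwa [← hk])
    push_cast at this
    rwa [← hk] at this
  have minus {n : ℕ} (hn : IsSquare (n * (x - 1))) : SquarePM n x := by
    right
    have := isSquareInNat_of_isSquare (c := n) (k := k - 1) (by omega)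
      (by push_cast; rwa [← hk])
    push_cast at this
    rwa [← hk] at this
  -- The identity `(x + 1)(x - 1) = p₁p₂q y²` trades a class of `x + 1` for the complementary class
  -- of `x - 1`; `u` absorbs a leftover square factor.
  have swap {s t u : ℚ} (hs : IsSquare (s * (x + 1))) (hs0 : s ≠ 0)
      (hst : s * t = (p₁ * p₂ * q) * u ^ 2) : IsSquare (t * (x - 1)) := by
    have e : t * (x - 1) = (p₁ * p₂ * q * u * y) ^ 2 / (s * (x + 1)) := by
      rw [eq_div_iff (mul_ne_zero hs0 hx1)]
      push_cast at hN3
      linear_combination (x ^ 2 - 1) * hst + (p₁ * p₂ * q) * u ^ 2 * hN3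
    rw [e]
    exact (IsSquare.sq _).div hs
  have m₃ := H.mem.2.2
  have class_one : ¬ IsSquareIn (RealBiquadratic q (p₁ * p₂)) ε₃ := by
    intro hsq
    have h3 := (isSquareIn_mul_of_norm_eq_one H.mul.1 m₃ hxy hN3 (c := 1)).mp (by simpa using hsq)
    rw [mul_one] at h3
    have hself := isSquareIn_natCast_self (p₁ * p₂ * q)
    rcases h.isBiquadraticPair.isSquare_of_isSquareIn h3 with h' | h' | h' | h'
    · exact hnot (IsSquareIn.of_ratCast h')
    · exact h2q (plus (by push_cast; convert h' using 1; ring))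
    · refine h2q (minus ?_)
      push_cast at h' ⊢
      refine swap (s := 2 * (p₁ * p₂)) (u := 2) ?_ (mul_ne_zero two_ne_zero hp0) (by ring)
      convert h' using 1; ring
    · refine hnot ?_
      convert (IsSquareIn.of_ratCast h').div hself using 1
      push_cast
      have : (p₁ * p₂ * q : ℝ) ≠ 0 := by exact_mod_cast mul_ne_zero hp0 hq0
      rw [mul_div_cancel_right₀ _ this]
  have class_two : ¬ IsSquareIn (RealBiquadratic q (p₁ * p₂)) (ε₃ * 2) := by
    intro hsq
    have h3 := (isSquareIn_mul_of_norm_eq_one H.mul.1 m₃ hxy hN3 (c := 2)).mp hsq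
    have four {s : ℚ} (hs : IsSquare ((2 * x + 2) * 2 * s)) : IsSquare (s * (x + 1)) := by
      rw [show s * (x + 1) = (2 * x + 2) * 2 * s / (2 * 2) by ring]
      exact hs.div (IsSquare.mul_self 2)
    rcases h.isBiquadraticPair.isSquare_of_isSquareIn (c := (2 * x + 2) * 2)
      (by push_cast at h3 ⊢; exact h3) with h' | h' | h' | h'
    · exact h1 (plus (by push_cast; exact four (by rwa [mul_one])))
    · exact hq (plus (four h'))
    · exact hq (minus (swap (u := 1) (four h') (by push_cast; exact hp0) (by push_cast; ring)))
    · refine h1 (minus (swap (s := p₁ * p₂ * q) (u := 1) ?_ (mul_ne_zero hp0 hq0)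
        (by push_cast; ring)))
      have := four h'
      push_cast at this
      exact this
  have hc : Even c := by
    by_contra hc
    obtain ⟨n, rfl⟩ := Int.not_even_iff_odd.mp hc
    have ha' : IsSquareIn (RealBiquadratic q (p₁ * p₂)) (ε₃ * ε₁ ^ a) := by
      convert hac.div (.even_zpow m₃ (even_two_mul n)) using 1
      rw [zpow_add_one₀ H.pos.2.2.ne']
      have := zpow_ne_zero (2 * n) H.pos.2.2.ne'
      field_simp
    have hpos := H.pos.1.ne'
    rcases Int.even_or_odd' a with ⟨j, rfl | rfl⟩
    · apply class_one
      convert ha'.div (.even_zpow H.mem.1 (even_two_mul j)) using 1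
      have := zpow_ne_zero (2 * j) hpos
      field_simp
    · apply class_two
      convert (ha'.mul (H.isSquareIn_left_mul_two h)).div
        ((IsSquareIn.even_zpow H.mem.1 (even_two_mul j)).mul (.sq H.mem.1)) using 1
      rw [zpow_add_one₀ hpos]
      have := zpow_ne_zero (2 * j) hpos
      field_simp
  refine ⟨H.even_left h ?_, hb, hc⟩
  convert hac.div (.even_zpow m₃ hc) using 1
  have := zpow_ne_zero c H.pos.2.2.ne'
  field_simp

end QuadraticUnits

/-! ### From squares `c(x ± 1)` to square roots of units -/

namespace QuadraticUnits

variable {p₁ p₂ q : ℕ} {ε₁ ε₂ ε₃ : ℝ} {x y : ℚ}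

/-- The class of `ε₃` is that of `2(x + 1)`, and `x + 1` has the class of `c`. -/
theorem isSquareIn_of_squarePM (H : QuadraticUnits q (p₁ * p₂) ε₁ ε₂ ε₃)
    (h : PrimeTriple p₁ p₂ q) (hxy : ε₃ = x + y * √((p₁ * p₂ * q : ℕ) : ℝ)) {c : ℕ} (hc : c ≠ 0)
    (hsq : SquarePM c x) : IsSquareIn (RealBiquadratic q (p₁ * p₂)) (ε₃ * (2 * c)) := by
  obtain ⟨hAB, hN⟩ := IsIntegralUnit.exists_int_quadratic H.squarefree H.mul_ne
    (hxy ▸ H.mul.mem.2)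
  obtain ⟨-, hN⟩ := exists_int_of_mod_four_eq_three h.mul_mul_mod hAB hN
  rw [isSquareIn_mul_of_norm_eq_one H.mul.1 H.mem.2.2 hxy hN]
  have hm : IsSquareIn (RealBiquadratic q (p₁ * p₂)) ((p₁ * p₂ * q : ℕ) : ℝ) :=
    (isSquareIn_natCast_self _).mono (realQuadratic_mul_le q (p₁ * p₂))
  convert (hsq.isSquareIn hm hc (one_lt_of_norm_eq_one H.mul.1 hxy hN) hN).mul
    (.sq (natCast_mem_intermediateField _ 2)) using 1
  push_cast
  ring

theorem isSquareIn_of_squarePM_two_mul (H : QuadraticUnits q (p₁ * p₂) ε₁ ε₂ ε₃)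
    (h : PrimeTriple p₁ p₂ q) (hxy : ε₃ = x + y * √((p₁ * p₂ * q : ℕ) : ℝ))
    (hsq : SquarePM (2 * q) x) : IsSquareIn (RealBiquadratic q (p₁ * p₂)) ε₃ := by
  have hq0 : (q : ℝ) ≠ 0 := by exact_mod_cast h.prime.ne_zero
  convert (H.isSquareIn_of_squarePM h hxy (mul_ne_zero two_ne_zero h.prime.ne_zero) hsq).div
    ((isSquareIn_left q (p₁ * p₂)).mul (.sq (natCast_mem_intermediateField _ 2))) using 1
  push_cast
  field_simp

theorem isSquareIn_left_mul_of_squarePM (H : QuadraticUnits q (p₁ * p₂) ε₁ ε₂ ε₃)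
    (h : PrimeTriple p₁ p₂ q) (hxy : ε₃ = x + y * √((p₁ * p₂ * q : ℕ) : ℝ))
    (hsq : SquarePM 1 x ∨ SquarePM q x) :
    IsSquareIn (RealBiquadratic q (p₁ * p₂)) (ε₁ * ε₃) := by
  have hq0 : (q : ℝ) ≠ 0 := by exact_mod_cast h.prime.ne_zero
  have h2 : IsSquareIn (RealBiquadratic q (p₁ * p₂)) (ε₃ * 2) := by
    rcases hsq with hsq | hsq
    · simpa using H.isSquareIn_of_squarePM h hxy one_ne_zero hsq
    · convert (H.isSquareIn_of_squarePM h hxy h.prime.ne_zero hsq).div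
        (isSquareIn_left q (p₁ * p₂)) using 1
      field_simp
  convert ((H.isSquareIn_left_mul_two h).mul h2).div (.sq (natCast_mem_intermediateField _ 2))
    using 1
  push_cast
  field_simp

/-- The primes `p₁` and `p₂` are interchangeable because `p₁p₂` is a square in the field. The values
`d = 1` and `d = 2` are the ones needed. -/
theorem isSquareIn_prime_mul_of_squarePM (H : QuadraticUnits q (p₁ * p₂) ε₁ ε₂ ε₃)
    (h : PrimeTriple p₁ p₂ q) (hxy : ε₃ = x + y * √((p₁ * p₂ * q : ℕ) : ℝ)) {d : ℕ} (hd : d ≠ 0)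
    (hsq : SquarePM (d * p₁) x ∨ SquarePM (d * p₂) x) :
    IsSquareIn (RealBiquadratic q (p₁ * p₂)) (ε₃ * (2 * (d * p₁))) := by
  rcases hsq with hsq | hsq
  · exact_mod_cast H.isSquareIn_of_squarePM h hxy (mul_ne_zero hd h.prime₁.ne_zero) hsq
  · have hp : (p₂ : ℝ) ≠ 0 := by exact_mod_cast h.prime₂.ne_zero
    convert ((H.isSquareIn_of_squarePM h hxy (mul_ne_zero hd h.prime₂.ne_zero) hsq).mul
      (isSquareIn_right q (p₁ * p₂))).div (.sq (natCast_mem_intermediateField _ p₂)) using 1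
    push_cast
    field_simp

theorem isSquareIn_mul_mul_of_squarePM (H : QuadraticUnits q (p₁ * p₂) ε₁ ε₂ ε₃)
    (h : PrimeTriple p₁ p₂ q) (hN : HasQuadraticNorm (p₁ * p₂) ε₂ 1)
    (hxy : ε₃ = x + y * √((p₁ * p₂ * q : ℕ) : ℝ)) (hsq : SquarePM p₁ x ∨ SquarePM p₂ x) :
    IsSquareIn (RealBiquadratic q (p₁ * p₂)) (ε₁ * ε₂ * ε₃) := by
  have hp : (p₁ : ℝ) ≠ 0 := by exact_mod_cast h.prime₁.ne_zero
  convert (((H.isSquareIn_left_mul_two h).mul (H.isSquareIn_right_mul_prime h hN)).mul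
    (H.isSquareIn_prime_mul_of_squarePM h hxy one_ne_zero (by simpa using hsq))).div
    (.sq (natCast_mem_intermediateField _ (2 * p₁))) using 1
  push_cast
  field_simp

theorem isSquareIn_right_mul_of_squarePM (H : QuadraticUnits q (p₁ * p₂) ε₁ ε₂ ε₃)
    (h : PrimeTriple p₁ p₂ q) (hN : HasQuadraticNorm (p₁ * p₂) ε₂ 1)
    (hxy : ε₃ = x + y * √((p₁ * p₂ * q : ℕ) : ℝ))
    (hsq : SquarePM (2 * p₁) x ∨ SquarePM (2 * p₂) x) :
    IsSquareIn (RealBiquadratic q (p₁ * p₂)) (ε₂ * ε₃) := by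
  have hp : (p₁ : ℝ) ≠ 0 := by exact_mod_cast h.prime₁.ne_zero
  convert ((H.isSquareIn_right_mul_prime h hN).mul
    (H.isSquareIn_prime_mul_of_squarePM h hxy two_ne_zero hsq)).div
    (.sq (natCast_mem_intermediateField _ (2 * p₁))) using 1
  push_cast
  field_simp

theorem isRealFSU_sqrt (H : QuadraticUnits q (p₁ * p₂) ε₁ ε₂ ε₃)
    (h : PrimeTriple p₁ p₂ q)
    (hN : HasQuadraticNorm (p₁ * p₂) ε₂ 1 ∨ HasQuadraticNorm (p₁ * p₂) ε₂ (-1)) {z : ℝ} (α β : ℤ)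
    (hz : z = ε₁ ^ α * ε₂ ^ β * ε₃) (hsq : IsSquareIn (RealBiquadratic q (p₁ * p₂)) z) :
    IsRealFSU q (p₁ * p₂) ε₁ ε₂ √z := by
  obtain ⟨h1, h2, h3⟩ := H.pos
  have hpos : 0 < z := by rw [hz]; positivity
  refine H.isRealFSU_of_sq_eq (Real.sqrt_pos.mpr hpos) hsq.sqrt_mem (α := α) (β := β)
    (by rw [Real.sq_sqrt hpos.le, hz]) fun a b hab => ?_
  rcases hN with hN | hN
  · exact H.even_of_norm_eq_one h hN hab
  · exact H.even_of_norm_eq_neg_one h hN hab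

end QuadraticUnits

/-! ### The CM field and its Hasse unit index -/

/-- A field generated over `ℚ` by square roots of rational numbers is abelian. -/
theorem isAbelianGalois_adjoin_of_sq_mem {L : Type*} [Field L] [CharZero L] {S : Set L}
    (hS : ∀ s ∈ S, ∃ c : ℚ, s ^ 2 = c) : IsAbelianGalois ℚ (IntermediateField.adjoin ℚ S) := by
  have := isGalois_adjoin_of_sq_mem hS
  refine { is_comm := ⟨fun σ τ => ?_⟩ }
  have key (x : L) (hx : x ∈ IntermediateField.adjoin ℚ S) : σ (τ ⟨x, hx⟩) = τ (σ ⟨x, hx⟩) := by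
    induction hx using IntermediateField.adjoin_induction with
    | mem x hx =>
      obtain ⟨c, hc⟩ := hS x hx
      set s : IntermediateField.adjoin ℚ S := ⟨x, IntermediateField.subset_adjoin _ _ hx⟩
      have hs : s ^ 2 = c := Subtype.ext (by push_cast; exact hc)
      have hσ : σ s = s ∨ σ s = -s := map_eq_or_eq_neg_of_sq_eq
        (σ : _ →ₐ[ℚ] IntermediateField.adjoin ℚ S) (AlgHom.id ℚ _) hs
      have hτ : τ s = s ∨ τ s = -s := map_eq_or_eq_neg_of_sq_eq
        (τ : _ →ₐ[ℚ] IntermediateField.adjoin ℚ S) (AlgHom.id ℚ _) hs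
      rcases hσ with hσ | hσ <;> rcases hτ with hτ | hτ <;> simp [hσ, hτ]
    | algebraMap x =>
      have e : (⟨algebraMap ℚ L x, IntermediateField.algebraMap_mem _ x⟩ :
        IntermediateField.adjoin ℚ S) = algebraMap ℚ _ x := Subtype.ext (by simp)
      rw [e]
      simp only [AlgEquiv.commutes]
    | add x y hx hy h1 h2 =>
      have e : (⟨x + y, add_mem hx hy⟩ : IntermediateField.adjoin ℚ S) = ⟨x, hx⟩ + ⟨y, hy⟩ := rfl
      rw [e, map_add, map_add, map_add, map_add, h1, h2]
    | mul x y hx hy h1 h2 =>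
      have e : (⟨x * y, mul_mem hx hy⟩ : IntermediateField.adjoin ℚ S) = ⟨x, hx⟩ * ⟨y, hy⟩ := rfl
      rw [e, map_mul, map_mul, map_mul, map_mul, h1, h2]
    | inv x hx h1 =>
      have e : (⟨x⁻¹, inv_mem hx⟩ : IntermediateField.adjoin ℚ S) = (⟨x, hx⟩)⁻¹ := rfl
      rw [e, map_inv₀, map_inv₀, map_inv₀, map_inv₀, h1]
  exact AlgEquiv.ext fun z => key z z.2

section FieldK

variable {q r : ℕ}

theorem sq_eq_ratCast_of_mem_triple : ∀ s ∈ ({((√(q : ℝ) : ℝ) : ℂ), ((√(r : ℝ) : ℝ) : ℂ),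
    Complex.I} : Set ℂ), ∃ c : ℚ, s ^ 2 = c := by
  rintro s (rfl | rfl | rfl)
  · exact ⟨q, by norm_cast; simp⟩
  · exact ⟨r, by norm_cast; simp⟩
  · exact ⟨-1, by simp⟩

/-- An abelian extension of `ℚ` that is totally complex is a CM field. -/
instance : IsAbelianGalois ℚ (FieldK q r) :=
  isAbelianGalois_adjoin_of_sq_mem sq_eq_ratCast_of_mem_triple

instance : NumberField (FieldK q r) where
  to_finiteDimensional := finiteDimensional_adjoin_of_sq_mem sq_eq_ratCast_of_mem_triple

theorem I_mem_fieldK : Complex.I ∈ FieldK q r :=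
  IntermediateField.subset_adjoin _ _ (by simp)

instance : IsTotallyComplex (FieldK q r) where
  isComplex v := by
    by_contra hv
    rw [InfinitePlace.not_isComplex_iff_isReal, InfinitePlace.isReal_iff] at hv
    let i : FieldK q r := ⟨Complex.I, I_mem_fieldK⟩
    have hi : i ^ 2 = -1 := Subtype.ext (by simp [i])
    have h1 : (v.embedding i) ^ 2 = -1 := by rw [← map_pow, hi]; simp
    have h2 := congrArg (fun f : FieldK q r →+* ℂ => f i) hv
    simp only [ComplexEmbedding.conjugate_coe_eq] at h2
    obtain ⟨t, ht⟩ := Complex.conj_eq_iff_real.mp h2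
    rw [ht] at h1
    have h3 : t ^ 2 = -1 := by exact_mod_cast h1
    nlinarith [sq_nonneg t]

theorem ofReal_mem_fieldK {x : ℝ} (hx : x ∈ RealBiquadratic q r) : (x : ℂ) ∈ FieldK q r := by
  obtain ⟨a, b, c, d, rfl⟩ := mem_realBiquadratic_iff.mp hx
  have hQ (t : ℚ) : (t : ℂ) ∈ FieldK q r := IntermediateField.algebraMap_mem _ t
  have hs : ((√(q : ℝ) : ℝ) : ℂ) ∈ FieldK q r := IntermediateField.subset_adjoin _ _ (by simp)
  have ht : ((√(r : ℝ) : ℝ) : ℂ) ∈ FieldK q r := IntermediateField.subset_adjoin _ _ (by simp)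
  push_cast
  exact add_mem (add_mem (add_mem (hQ a) (mul_mem (hQ b) hs)) (mul_mem (hQ c) ht))
    (mul_mem (hQ d) (mul_mem hs ht))

theorem re_mem_and_im_mem_of_mem_fieldK {z : ℂ} (hz : z ∈ FieldK q r) :
    z.re ∈ RealBiquadratic q r ∧ z.im ∈ RealBiquadratic q r := by
  induction hz using IntermediateField.adjoin_induction with
  | mem x hx =>
    rcases hx with rfl | rfl | rfl
    · simpa using sqrt_left_mem q r
    · simpa using sqrt_right_mem q r
    · simp
  | algebraMap x => simp
  | add x y _ _ hx hy => exact ⟨add_mem hx.1 hy.1, add_mem hx.2 hy.2⟩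
  | mul x y _ _ hx hy =>
    rw [Complex.mul_re, Complex.mul_im]
    exact ⟨sub_mem (mul_mem hx.1 hy.1) (mul_mem hx.2 hy.2),
      add_mem (mul_mem hx.1 hy.2) (mul_mem hx.2 hy.1)⟩
  | inv x _ hx =>
    rw [Complex.inv_re, Complex.inv_im, Complex.normSq_apply]
    have hn := add_mem (mul_mem hx.1 hx.1) (mul_mem hx.2 hx.2)
    exact ⟨div_mem hx.1 hn, div_mem (neg_mem hx.2) hn⟩

/-- The maximal real subfield of `ℚ(√q, √r, i)` is `ℚ(√q, √r)`. -/
theorem mem_range_maximalRealSubfield_iff {z : ℂ} :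
    z ∈ ((algebraMap (FieldK q r) ℂ).comp (maximalRealSubfield (FieldK q r)).subtype).range ↔
      ∃ x ∈ RealBiquadratic q r, z = x := by
  have hreal (k : FieldK q r) : k ∈ maximalRealSubfield (FieldK q r) ↔
      (starRingEnd ℂ) (k : ℂ) = k := by
    rw [← IsCMField.complexConj_eq_self_iff]
    have h := IsCMField.complexEmbedding_complexConj (FieldK q r) (algebraMap (FieldK q r) ℂ) k
    refine ⟨fun e => ?_, fun e => ?_⟩
    · rw [e] at h
      exact h.symm
    · exact (algebraMap (FieldK q r) ℂ).injective (h.trans e)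
  constructor
  · rintro ⟨⟨k, hk⟩, rfl⟩
    rw [hreal] at hk
    obtain ⟨t, ht⟩ := Complex.conj_eq_iff_real.mp hk
    refine ⟨t, ?_, ht⟩
    have := (re_mem_and_im_mem_of_mem_fieldK k.2).1
    rwa [ht, Complex.ofReal_re] at this
  · rintro ⟨x, hx, rfl⟩
    refine ⟨⟨⟨x, ofReal_mem_fieldK hx⟩, (hreal _).mpr ?_⟩, rfl⟩
    simp

theorem isIntegralUnit_ofReal_iff {x : ℝ} : IsIntegralUnit (x : ℂ) ↔ IsIntegralUnit x :=
  IsIntegralUnit.map_iff Complex.ofRealHom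

theorem IsRealFSU.isFSUPlus {u v w : ℝ} (h : IsRealFSU q r u v w) : IsFSUPlus q r ![u, v, w] := by
  refine (isFundamentalSystemIn_iff _ _).mpr ⟨?_, ?_, ?_⟩
  · intro i
    rw [mem_range_maximalRealSubfield_iff, isIntegralUnit_ofReal_iff]
    fin_cases i
    · exact ⟨⟨u, h.mem.1, rfl⟩, h.unit.1⟩
    · exact ⟨⟨v, h.mem.2.1, rfl⟩, h.unit.2.1⟩
    · exact ⟨⟨w, h.mem.2.2, rfl⟩, h.unit.2.2⟩
  · intro z hz hu
    obtain ⟨x, hx, rfl⟩ := mem_range_maximalRealSubfield_iff.mp hz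
    rw [isIntegralUnit_ofReal_iff] at hu
    rcases hu.1.lt_or_gt with h0 | h0
    · obtain ⟨a, b, c, e⟩ := h.exists_eq (-x) (neg_mem hx) hu.neg (neg_pos.mpr h0)
      refine ⟨-1, ⟨2, two_pos, by norm_num⟩, ![a, b, c], ?_⟩
      rw [← neg_neg x, e]
      simp [Fin.prod_univ_three]
    · obtain ⟨a, b, c, e⟩ := h.exists_eq x hx hu h0
      refine ⟨1, ⟨1, one_pos, by norm_num⟩, ![a, b, c], ?_⟩
      rw [e]
      simp [Fin.prod_univ_three]
  · intro e k hk he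
    obtain ⟨h1, h2, h3⟩ := h.pos
    have he' : (u ^ e 0 * v ^ e 1 * w ^ e 2) ^ k = 1 := by
      simp only [Fin.prod_univ_three] at he
      exact_mod_cast he
    rw [pow_eq_one_iff_of_nonneg (by positivity) hk.ne'] at he'
    obtain ⟨e0, e1, e2⟩ := h.indep _ _ _ he'
    ext i
    fin_cases i <;> assumption

theorem csqrt_sq (z : ℂ) : csqrt z ^ 2 = z := Complex.cpow_ofNat_inv_pow z 2

/-- Since `((1 + i)/2)² = i/2`, the number `(1 + i)/2 · √(2ε)` is a square root of `iε`, and the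
principal root agrees with it up to sign. -/
theorem csqrt_mem_fieldK {ε : ℝ} (h : IsSquareIn (RealBiquadratic q r) (ε * 2)) :
    csqrt (Complex.I * ε) ∈ FieldK q r := by
  obtain ⟨w, hw, e⟩ := h
  have e' : (w : ℂ) ^ 2 = ε * 2 := by exact_mod_cast e
  have hmem : (1 + Complex.I) / 2 * w ∈ FieldK q r :=
    mul_mem (div_mem (add_mem (one_mem _) I_mem_fieldK) (by simp)) (ofReal_mem_fieldK hw)
  have hsq : csqrt (Complex.I * ε) ^ 2 = ((1 + Complex.I) / 2 * w) ^ 2 := by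
    rw [csqrt_sq, mul_pow, e']
    linear_combination (-(ε : ℂ) / 2) * Complex.I_sq
  rcases sq_eq_sq_iff_eq_or_eq_neg.mp hsq with h | h <;> rw [h]
  · exact hmem
  · exact neg_mem hmem

theorem isIntegralUnit_csqrt {ε : ℝ} (h : IsIntegralUnit ε) :
    IsIntegralUnit (csqrt (Complex.I * ε)) := by
  apply IsIntegralUnit.of_sq
  rw [csqrt_sq]
  refine IsIntegralUnit.mul (IsIntegralUnit.of_sq ?_) (isIntegralUnit_ofReal_iff.mpr h)
  rw [Complex.I_sq]
  exact IsIntegralUnit.one.neg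

theorem norm_csqrt_sq {ε : ℝ} (h : 0 < ε) : ‖csqrt (Complex.I * ε)‖ ^ 2 = ε := by
  rw [← norm_pow, csqrt_sq, norm_mul, Complex.norm_I, one_mul, Complex.norm_real,
    Real.norm_of_nonneg h.le]

/-- The elements of `W E⁺` are the products of a unit of `ℚ(√q, √r)` and a root of unity. -/
theorem exists_eq_mul_of_mem_sup {v : (𝓞 (FieldK q r))ˣ}
    (hv : v ∈ IsCMField.realUnits (FieldK q r) ⊔ Units.torsion (FieldK q r)) :
    ∃ x ∈ RealBiquadratic q r, IsIntegralUnit x ∧ ∃ ζ : ℂ, (∃ k : ℕ, 0 < k ∧ ζ ^ k = 1) ∧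
      ((v : FieldK q r) : ℂ) = ζ * x := by
  obtain ⟨y, hy, t, ht, rfl⟩ := Subgroup.mem_sup.mp hv
  obtain ⟨y', rfl⟩ := hy
  obtain ⟨k, hk, h1⟩ := isOfFinOrder_iff_pow_eq_one.mp ((CommGroup.mem_torsion _).mp ht)
  obtain ⟨h2, h3⟩ := (exists_unit_map_eq_iff
    ((algebraMap (FieldK q r) ℂ).comp (maximalRealSubfield (FieldK q r)).subtype) _).mp ⟨y', rfl⟩
  obtain ⟨x, hx, e⟩ := mem_range_maximalRealSubfield_iff.mp h2
  refine ⟨x, hx, by rwa [e, isIntegralUnit_ofReal_iff] at h3, ((t : FieldK q r) : ℂ),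
    ⟨k, hk, ?_⟩, ?_⟩
  · have := congrArg (fun t : (𝓞 (FieldK q r))ˣ => algebraMap (FieldK q r) ℂ (t : FieldK q r)) h1
    simpa using this
  · rw [← e, mul_comm, Units.coe_mul]
    rfl

theorem norm_eq_one_of_exists_pow_eq_one {ζ : ℂ} (h : ∃ k : ℕ, 0 < k ∧ ζ ^ k = 1) : ‖ζ‖ = 1 := by
  obtain ⟨k, hk, e⟩ := h
  exact Complex.norm_eq_one_of_pow_eq_one e hk.ne'

/-- In `θ = ζx` with `ζ` a root of unity and `x` real, taking absolute values gives `ε = |θ|² = x²`.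
-/
theorem csqrt_notMem_sup {ε : ℝ} (hε : 0 < ε) (hsq : ¬ IsSquareIn (RealBiquadratic q r) ε)
    {θ : (𝓞 (FieldK q r))ˣ} (hθ : ((θ : FieldK q r) : ℂ) = csqrt (Complex.I * ε)) :
    θ ∉ IsCMField.realUnits (FieldK q r) ⊔ Units.torsion (FieldK q r) := by
  intro hmem
  obtain ⟨x, hx, -, ζ, hζ, e⟩ := exists_eq_mul_of_mem_sup hmem
  refine hsq ⟨x, hx, ?_⟩
  rw [← norm_csqrt_sq hε, ← hθ, e, norm_mul, norm_eq_one_of_exists_pow_eq_one hζ, one_mul,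
    Complex.norm_real, Real.norm_eq_abs, sq_abs]

theorem indexRealUnits_fieldK {ε : ℝ} (hε : 0 < ε) (hu : IsIntegralUnit ε)
    (h2 : IsSquareIn (RealBiquadratic q r) (ε * 2))
    (hsq : ¬ IsSquareIn (RealBiquadratic q r) ε) : IsCMField.indexRealUnits (FieldK q r) = 2 := by
  obtain ⟨θ, hθ⟩ := (exists_unit_map_eq_iff (algebraMap (FieldK q r) ℂ) _).mpr
    ⟨⟨⟨_, csqrt_mem_fieldK h2⟩, rfl⟩, isIntegralUnit_csqrt hu⟩
  refine (IsCMField.indexRealUnits_eq_one_or_two _).resolve_left fun h1 => ?_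
  apply csqrt_notMem_sup hε hsq hθ
  rw [Subgroup.index_eq_one.mp h1]
  trivial

/-- With `t = √(iε)` one has `ε = -i t²`, so powers of `ε` become even powers of `t` times roots of
unity. This covers the subgroup generated by the real units and the roots of unity; its index is
`2`, so `t` reaches the other coset. Independence follows from absolute values and `|t|² = ε`. -/
theorem IsRealFSU.isFSU {ε u v : ℝ} (h : IsRealFSU q r ε u v)
    (h2 : IsSquareIn (RealBiquadratic q r) (ε * 2))
    (hsq : ¬ IsSquareIn (RealBiquadratic q r) ε) :
    IsFSU q r ![(u : ℂ), (v : ℂ), csqrt (Complex.I * ε)] := by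
  obtain ⟨pε, pu, pv⟩ := h.pos
  have hmem := csqrt_mem_fieldK h2
  have hunit := isIntegralUnit_csqrt h.unit.1
  have hindex := indexRealUnits_fieldK pε h.unit.1 h2 hsq
  have hθ2 := csqrt_sq (Complex.I * ε)
  have hnorm := norm_csqrt_sq pε
  obtain ⟨θ, hθ⟩ := (exists_unit_map_eq_iff (algebraMap (FieldK q r) ℂ) _).mpr
    ⟨⟨⟨_, hmem⟩, rfl⟩, hunit⟩
  have hθ' : ((θ : FieldK q r) : ℂ) = csqrt (Complex.I * ε) := hθ
  have hnot := csqrt_notMem_sup pε hsq hθ'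
  generalize csqrt (Complex.I * ε) = t at *
  have hroot {ζ : ℂ} (hζ : ∃ k : ℕ, 0 < k ∧ ζ ^ k = 1) (a : ℤ) (s : ℂ) (hs : s ^ 2 = 1) :
      ∃ k : ℕ, 0 < k ∧ (ζ * s * ((-Complex.I) ^ a)) ^ k = 1 := by
    obtain ⟨k, hk, e⟩ := hζ
    refine ⟨k * 4, by positivity, ?_⟩
    have hI : ((-Complex.I) ^ a) ^ (k * 4) = 1 := by
      rw [← zpow_natCast, zpow_comm, zpow_natCast, mul_comm, pow_mul, neg_pow, Complex.I_pow_four]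
      norm_num
    rw [mul_pow, mul_pow, hI, pow_mul, e, show k * 4 = 2 * (2 * k) by ring, pow_mul s, hs]
    simp
  have hε : (ε : ℂ) = -Complex.I * t ^ 2 := by
    rw [hθ2, ← mul_assoc, neg_mul, Complex.I_mul_I, neg_neg, one_mul]
  have ht0 : t ≠ 0 := hunit.1
  have main {w : (𝓞 (FieldK q r))ˣ}
      (hw : w ∈ IsCMField.realUnits (FieldK q r) ⊔ Units.torsion (FieldK q r)) :
      ∃ ζ : ℂ, (∃ k : ℕ, 0 < k ∧ ζ ^ k = 1) ∧ ∃ a b c : ℤ,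
        ((w : FieldK q r) : ℂ) = ζ * (u ^ a * v ^ b * t ^ c) := by
    obtain ⟨x, hx, hxu, ζ, hζ, e⟩ := exists_eq_mul_of_mem_sup hw
    obtain ⟨s, hs, hsx, hpos⟩ : ∃ s : ℝ, s ^ 2 = 1 ∧ x = s * |x| ∧ 0 < |x| := by
      refine ⟨SignType.sign x, ?_, (sign_mul_abs x).symm, abs_pos.mpr hxu.1⟩
      rcases hxu.1.lt_or_gt with h0 | h0 <;> simp [h0]
    have hax : |x| ∈ RealBiquadratic q r ∧ IsIntegralUnit |x| := by
      rcases abs_choice x with h0 | h0 <;> rw [h0]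
      · exact ⟨hx, hxu⟩
      · exact ⟨neg_mem hx, hxu.neg⟩
    obtain ⟨a, b, c, e'⟩ := h.exists_eq |x| hax.1 hax.2 hpos
    refine ⟨ζ * s * (-Complex.I) ^ a, hroot hζ a s (by exact_mod_cast hs), b, c, 2 * a, ?_⟩
    rw [e, hsx, e']
    push_cast
    rw [hε, mul_zpow, zpow_mul t, zpow_ofNat]
    ring
  refine (isFundamentalSystemIn_iff _ _).mpr ⟨?_, ?_, ?_⟩
  · intro i
    fin_cases i
    · exact ⟨⟨⟨_, ofReal_mem_fieldK h.mem.2.1⟩, rfl⟩, isIntegralUnit_ofReal_iff.mpr h.unit.2.1⟩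
    · exact ⟨⟨⟨_, ofReal_mem_fieldK h.mem.2.2⟩, rfl⟩, isIntegralUnit_ofReal_iff.mpr h.unit.2.2⟩
    · exact ⟨⟨⟨_, hmem⟩, rfl⟩, hunit⟩
  · intro z hz hu
    obtain ⟨w, hw⟩ := (exists_unit_map_eq_iff _ z).mpr ⟨hz, hu⟩
    have hw' : ((w : FieldK q r) : ℂ) = z := hw
    by_cases hwm : w ∈ IsCMField.realUnits (FieldK q r) ⊔ Units.torsion (FieldK q r)
    · obtain ⟨ζ, hζ, a, b, c, e⟩ := main hwm
      refine ⟨ζ, hζ, ![a, b, c], ?_⟩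
      rw [← hw', e]
      simp [Fin.prod_univ_three]
    -- Neither `w` nor `θ` lies in the subgroup of index `2`, so their product does; dividing by `t`
    -- lowers its exponent by one.
    · obtain ⟨ζ, hζ, a, b, c, e⟩ := main (w := w * θ)
        ((Subgroup.mul_mem_iff_of_index_two hindex).mpr (by simp [hwm, hnot]))
      refine ⟨ζ, hζ, ![a, b, c - 1], ?_⟩
      have e' : z * t = ζ * (u ^ a * v ^ b * t ^ c) := by
        rw [← e, ← hw', ← hθ', Units.coe_mul]
        rfl
      rw [eq_comm, ← mul_left_inj' ht0, e']
      simp [Fin.prod_univ_three, zpow_sub_one₀ ht0]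
      field_simp
  · intro e k hk he
    simp only [Fin.prod_univ_three] at he
    have he1 := norm_eq_one_of_exists_pow_eq_one ⟨k, hk, he⟩
    have he2 : u ^ e 0 * v ^ e 1 * ‖t‖ ^ e 2 = 1 := by
      simpa [abs_of_pos pu, abs_of_pos pv] using he1
    have he3 : ε ^ e 2 * u ^ (2 * e 0) * v ^ (2 * e 1) = 1 := by
      have := congrArg (· ^ 2) he2
      simp only [mul_pow, one_pow] at this
      rw [← this, ← hnorm, two_mul, two_mul, zpow_add₀ pu.ne', zpow_add₀ pv.ne',
        ← zpow_natCast, ← zpow_natCast (‖t‖ ^ e 2), zpow_comm]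
      ring
    obtain ⟨e0, e1, e2⟩ := h.indep _ _ _ he3
    ext i
    fin_cases i
    · change e 0 = 0; omega
    · change e 1 = 0; omega
    · exact e0

end FieldK

/-! ### The main theorem -/

theorem mainTheorem10 (p₁ p₂ q : ℕ) (hp₁ : p₁.Prime) (hp₂ : p₂.Prime) (hq : q.Prime)
    (hne : p₁ ≠ p₂) (h₁ : p₁ ≡ 1 [MOD 4]) (h₂ : p₂ ≡ 1 [MOD 4]) (h₃ : q ≡ 3 [MOD 4])
    (εq ε₁₂ ε₁₂q : ℝ) (hεq : IsFundamentalUnit q εq)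
    (hε₁₂ : IsFundamentalUnit (p₁ * p₂) ε₁₂)
    (hε₁₂q : IsFundamentalUnit (p₁ * p₂ * q) ε₁₂q)
    (x y : ℚ) (hxy : ε₁₂q = x + y * √((p₁ * p₂ * q : ℕ) : ℝ)) :
    IsCMField (FieldK q (p₁ * p₂)) ∧
    IsCMField.indexRealUnits (FieldK q (p₁ * p₂)) = 2 ∧
    (HasQuadraticNorm (p₁ * p₂) ε₁₂ 1 →
      (SquarePM (2 * q) x →
          IsFSUPlus q (p₁ * p₂) ![εq, ε₁₂, √ε₁₂q] ∧
          IsFSU q (p₁ * p₂) ![(ε₁₂ : ℂ), ((√ε₁₂q : ℝ) : ℂ), csqrt (Complex.I * εq)]) ∧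
      (SquarePM 1 x ∨ SquarePM q x →
          IsFSUPlus q (p₁ * p₂) ![εq, ε₁₂, √(εq * ε₁₂q)] ∧
          IsFSU q (p₁ * p₂) ![(ε₁₂ : ℂ), ((√(εq * ε₁₂q) : ℝ) : ℂ), csqrt (Complex.I * εq)]) ∧
      (SquarePM p₁ x ∨ SquarePM p₂ x →
          IsFSUPlus q (p₁ * p₂) ![εq, ε₁₂, √(εq * ε₁₂ * ε₁₂q)] ∧
          IsFSU q (p₁ * p₂) ![(ε₁₂ : ℂ), ((√(εq * ε₁₂ * ε₁₂q) : ℝ) : ℂ), csqrt (Complex.I * εq)]) ∧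
      (SquarePM (2 * p₁) x ∨ SquarePM (2 * p₂) x →
          IsFSUPlus q (p₁ * p₂) ![εq, ε₁₂, √(ε₁₂ * ε₁₂q)] ∧
          IsFSU q (p₁ * p₂) ![(ε₁₂ : ℂ), ((√(ε₁₂ * ε₁₂q) : ℝ) : ℂ), csqrt (Complex.I * εq)])) ∧
    (HasQuadraticNorm (p₁ * p₂) ε₁₂ (-1) →
      (SquarePM (2 * q) x →
          IsFSUPlus q (p₁ * p₂) ![εq, ε₁₂, √ε₁₂q] ∧
          IsFSU q (p₁ * p₂) ![(ε₁₂ : ℂ), ((√ε₁₂q : ℝ) : ℂ), csqrt (Complex.I * εq)]) ∧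
      (SquarePM 1 x ∨ SquarePM q x →
          IsFSUPlus q (p₁ * p₂) ![εq, ε₁₂, √(εq * ε₁₂q)] ∧
          IsFSU q (p₁ * p₂) ![(ε₁₂ : ℂ), ((√(εq * ε₁₂q) : ℝ) : ℂ), csqrt (Complex.I * εq)]) ∧
      (¬ SquarePM (2 * q) x ∧ ¬ SquarePM 1 x ∧ ¬ SquarePM q x →
          IsFSUPlus q (p₁ * p₂) ![εq, ε₁₂, ε₁₂q] ∧
          IsFSU q (p₁ * p₂) ![(ε₁₂ : ℂ), ((ε₁₂q : ℝ) : ℂ), csqrt (Complex.I * εq)])) := by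
  have T : PrimeTriple p₁ p₂ q := ⟨hp₁, hp₂, hq, hne, h₁, h₂, h₃⟩
  have H : QuadraticUnits q (p₁ * p₂) εq ε₁₂ ε₁₂q :=
    ⟨T.squarefree, hq.ne_one, T.mul_ne_one, hεq, hε₁₂, hε₁₂q⟩
  have two := H.isSquareIn_left_mul_two T
  -- The class of `εq` is that of `2`, which is not a square in the real field; together with `two`
  -- this gives Hasse index `2`.
  have nsq : ¬ IsSquareIn (RealBiquadratic q (p₁ * p₂)) εq := fun hsq =>
    Int.not_even_one (H.even_left T (by rwa [zpow_one]))
  have fsu {w : ℝ} (h : IsRealFSU q (p₁ * p₂) εq ε₁₂ w) :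
      IsFSUPlus q (p₁ * p₂) ![εq, ε₁₂, w] ∧
        IsFSU q (p₁ * p₂) ![(ε₁₂ : ℂ), (w : ℂ), csqrt (Complex.I * εq)] :=
    ⟨h.isFSUPlus, h.isFSU two nsq⟩
  refine ⟨inferInstance, indexRealUnits_fieldK H.pos.1 hεq.mem.2 two nsq,
    fun hN => ⟨fun hs => fsu ?_, fun hs => fsu ?_, fun hs => fsu ?_, fun hs => fsu ?_⟩,
    fun hN => ⟨fun hs => fsu ?_, fun hs => fsu ?_, fun hs => fsu ?_⟩⟩
  · exact H.isRealFSU_sqrt T (.inl hN) 0 0 (by simp) (H.isSquareIn_of_squarePM_two_mul T hxy hs)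
  · exact H.isRealFSU_sqrt T (.inl hN) 1 0 (by simp) (H.isSquareIn_left_mul_of_squarePM T hxy hs)
  · exact H.isRealFSU_sqrt T (.inl hN) 1 1 (by simp)
      (H.isSquareIn_mul_mul_of_squarePM T hN hxy hs)
  · exact H.isRealFSU_sqrt T (.inl hN) 0 1 (by simp)
      (H.isSquareIn_right_mul_of_squarePM T hN hxy hs)
  · exact H.isRealFSU_sqrt T (.inr hN) 0 0 (by simp) (H.isSquareIn_of_squarePM_two_mul T hxy hs)
  · exact H.isRealFSU_sqrt T (.inr hN) 1 0 (by simp) (H.isSquareIn_left_mul_of_squarePM T hxy hs)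
  · exact H.isRealFSU_of_even fun a b c habc =>
      H.even_of_not_squarePM T hN hxy hs.1 hs.2.1 hs.2.2 habc
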